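/- All graphs are finite and simple; $v(\cdot)$ and $e(\cdot)$ denote the numbers of vertices and edges. For a graph $H$ with $v(H)\ge 3$ put $$m_2(H)=\max\Big\{\frac{e(H')-1}{v(H')-2} : H'\subseteq H,\ v(H')\ge 3\Big\}.$$ A bipartite graph between finite sets $V_1$ and $V_2$ is called $(\varepsilon,p)$-regular if $|d(W_1,W_2)-d(V_1,V_2)|\le \varepsilon p$ for all $W_1\subseteq V_1$ and $W_2\subseteq V_2$ with $|W_1|\ge\varepsilon|V_1|$ and $|W_2|\ge\varepsilon|V_2|$, where $d(W_1,W_2)=e(W_1,W_2)/(|W_1||W_2|)$ is the edge density. Let $\mathcal G(H,n,m,p,\varepsilon)$ be the set of all graphs $G$ whose vertex set is a (fixed) disjoint union $\bigcup_{i\in V(H)}V_i$ of sets of size $n$ such that, for each edge $\{i,j\}$ of $H$, the bipartite graph of the edges of $G$ between $V_i$ and $V_j$ is $(\varepsilon,p)$-regular and has exactly $m$ edges, and such that $G$ has no other edges. A canonical copy of $H$ in such a $G$ is a copy of $H$ in $G$ in which the image of each vertex $i\in V(H)$ lies in $V_i$. Let $\mathcal G^*(H,n,m,p,\varepsilon)$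 be the set of those graphs in $\mathcal G(H,n,m,p,\varepsilon)$ that contain no canonical copy of $H$. **Theorem 1.8 (the KŁR conjecture).** For every graph $H$ and every $\beta>0$ there exist positive constants $C$, $n_0$ and $\varepsilon$ such that the following holds. For every $n\in\mathbb N$ with $n\ge n_0$ and every $m\in\mathbb N$ with $m\ge Cn^{2-1/m_2(H)}$, $$\big|\mathcal G^*(H,n,m,m/n^2,\varepsilon)\big|\le \beta^m\binom{n^2}{m}^{e(H)}.$$ Here, if $e(H)\le 1$ (where $1/m_2(H)$ need not be defined), the condition $m\ge Cn^{2-1/m_2(H)}$ is omitted. -/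

import Mathlib

namespace KLR

/-- The 2-density `m₂(H)`: the maximum of `(e(H') - 1) / (v(H') - 2)` over all (not necessarily
induced) subgraphs `H' ⊆ H` with `v(H') ≥ 3`.  For a finite graph `H` this is a supremum of finitely
many real numbers, and there is at least one such `H'` as soon as `v(H) ≥ 3`. -/
noncomputable def twoDensity {V : Type*} (H : SimpleGraph V) : ℝ :=
  ⨆ H' : {H' : H.Subgraph // 3 ≤ H'.verts.ncard},
    ((H'.1.edgeSet.ncard : ℝ) - 1) / ((H'.1.verts.ncard : ℝ) - 2)

/-- The part `V_i = {i} × {0, …, n-1}` of the vertex set `V × Fin n` of an `n`-fold blow-up. -/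
def part {V : Type*} (n : ℕ) (i : V) : Finset (V × Fin n) :=
  {i} ×ˢ Finset.univ

open Classical in
/-- The bipartite graph that `G` induces between `A` and `B` is `(ε, p)`-regular. -/
def IsRegularPair {W : Type*} (G : SimpleGraph W) (ε p : ℝ) (A B : Finset W) : Prop :=
  ∀ W₁ ⊆ A, ∀ W₂ ⊆ B, ε * (A.card : ℝ) ≤ (W₁.card : ℝ) → ε * (B.card : ℝ) ≤ (W₂.card : ℝ) →
    |(G.edgeDensity W₁ W₂ : ℝ) - (G.edgeDensity A B : ℝ)| ≤ ε * p

open Classical in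
/-- The collection `𝒢(H, n, m, p, ε)` of graphs on the disjoint union of the `n`-element sets `V_i`,
`i ∈ V(H)`, consisting of one `(ε, p)`-regular bipartite graph with `m` edges between `V_i` and
`V_j` for each edge `{i, j}` of `H`, and of no other edges.  (Since `V_i` and `V_j` are disjoint,
`G.interedges V_i V_j` has one element for each edge of `G` between `V_i` and `V_j`.) -/
def blowupGraphs {V : Type*} (H : SimpleGraph V) (n m : ℕ) (p ε : ℝ) :
    Set (SimpleGraph (V × Fin n)) :=
  {G | (∀ x y, G.Adj x y → H.Adj x.1 y.1) ∧
    ∀ i j, H.Adj i j →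
      (G.interedges (part n i) (part n j)).card = m ∧
        IsRegularPair G ε p (part n i) (part n j)}

/-- `G` contains a canonical copy of `H`: a copy of `H` (as a not necessarily induced subgraph) in
which the image of each vertex `i` lies in `V_i`. -/
def HasCanonicalCopy {V : Type*} (H : SimpleGraph V) {n : ℕ} (G : SimpleGraph (V × Fin n)) : Prop :=
  ∃ f : SimpleGraph.Copy H G, ∀ i, f i ∈ part n i

/-- The collection `𝒢*(H, n, m, p, ε)` of the graphs in `𝒢(H, n, m, p, ε)` that contain no canonical
copy of `H`. -/
def canonicalFree {V : Type*} (H : SimpleGraph V) (n m : ℕ) (p ε : ℝ) :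
    Set (SimpleGraph (V × Fin n)) :=
  {G | G ∈ blowupGraphs H n m p ε ∧ ¬ HasCanonicalCopy H G}

end KLR

universe u

namespace KLR

section

open Classical

/-! A graph in `blowupGraphs` amounts to one `m`-subset of `Fin n × Fin n` for each of the `k` edges
of `H`. It has no canonical copy iff these sets form an independent set in the `k`-uniform
hypergraph whose vertices are the `k n²` possible edges and whose hyperedges are given by the maps
`φ : V → Fin n`. The bound combines containers for this hypergraph with a saturation property of
regular graphs.

Containers (`exists_container`): an independent set `S` lies in a set `C S` spanning few hyperedges,
and `C S` is determined by a fingerprint `T S ⊆ S` of size `O(b)`. This needs any `j` vertices to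
lie in at most about `(b / (k n²)) ^ (j - 1)` times the average degree many hyperedges. For `b` a
small multiple of `m`, the lower bound on `m` in terms of `m₂(H)` provides exactly that
(`card_edgeTuple_agree_le`).

Saturation (`exists_sparse_intersecting`): if all pairs of large subsets were dense, greedy
embedding would give many copies. So when copies are few, every box that is not too thin contains a
large sparse sub-box, and such sub-boxes can be split off until they fill half of the volume
(`exists_sparse_weight`). A regular graph spreads evenly over large boxes. Hence, for some edge of
`H`, there is one sparse set `B` that receives a fixed proportion of the edges of every regular
graph inside the container.

Counting (`card_le_of_fingerprint`): the fingerprint determines `B`, and many edges outside the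
fingerprint must fall into `B`. This costs a factor `δ ^ (m / (16 k)) * 2 ^ m`. Summing over
fingerprints costs only `2 ^ (k m)`, since each tuple has at most that many sub-tuples. A small `δ`
beats both. -/

/-! ### Adaptive queries -/

/-- `T` and `out` describe an adaptive querying procedure on subsets `S`: the elements found
form `T S ⊆ S`, and the run on `S` agrees with the run on any set between `T S` and `S`. -/
def IsQuery {β γ : Type*} (T : Finset β → Finset β) (out : Finset β → γ) : Prop :=
  (∀ S, T S ⊆ S) ∧ ∀ S S', T S ⊆ S' → S' ⊆ S → T S' = T S ∧ out S' = out S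

theorem IsQuery.pure {β γ : Type*} (y : γ) :
    IsQuery (fun _ : Finset β => ∅) (fun _ => y) :=
  ⟨fun _ => Finset.empty_subset _, fun _ _ _ _ => ⟨rfl, rfl⟩⟩

theorem IsQuery.bind {β γ γ' : Type*} [DecidableEq β] {T : Finset β → Finset β} {out : Finset β → γ}
    (h : IsQuery T out) {T' : γ → Finset β → Finset β} {out' : γ → Finset β → γ'}
    (h' : ∀ y, IsQuery (T' y) (out' y)) :
    IsQuery (fun S => T S ∪ T' (out S) S) (fun S => out' (out S) S) := by
  refine ⟨fun S => Finset.union_subset (h.1 S) ((h' _).1 S), fun S S' h1 h2 => ?_⟩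
  obtain ⟨e1, e2⟩ := h.2 S S' (Finset.union_subset_left h1) h2
  obtain ⟨e3, e4⟩ := (h' (out S)).2 S S' (Finset.union_subset_right h1) h2
  simp only [e1, e2, e3, e4, and_self]

theorem IsQuery.ask {β : Type*} [DecidableEq β] (v : β) :
    IsQuery (fun S : Finset β => S ∩ {v}) (fun S => decide (v ∈ S)) := by
  refine ⟨fun S => Finset.inter_subset_left, fun S S' h1 h2 => ?_⟩
  have : v ∈ S' ↔ v ∈ S := ⟨fun h => h2 h, fun h => h1 (by simp [h])⟩
  refine ⟨?_, by simp [this]⟩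
  ext x
  simp only [Finset.mem_inter, Finset.mem_singleton]
  constructor
  · rintro ⟨h, rfl⟩; exact ⟨this.1 h, rfl⟩
  · rintro ⟨h, rfl⟩; exact ⟨this.2 h, rfl⟩

/-- Running on the fingerprint itself reproduces both runs, so the fingerprint alone determines the
output. This recovers a container from its fingerprint. -/
theorem IsQuery.out_eq {β γ : Type*} {T : Finset β → Finset β} {out : Finset β → γ}
    (h : IsQuery T out) {S S' : Finset β} (e : T S = T S') : out S = out S' := by
  have h1 := (h.2 S (T S) subset_rfl (h.1 S)).2
  have h2 := (h.2 S' (T S) e.symm.subset (e ▸ h.1 S')).2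
  exact h1.symm.trans h2

/-! ### Weighted degrees and one round of the container algorithm -/

/-- The total weight of the `r`-class of `x`. -/
noncomputable def classSum {X : Type*} [Fintype X] (r : X → X → Prop) (y : X → ℝ) (x : X) : ℝ :=
  ∑ x', if r x x' then y x' else 0

theorem classSum_add {X : Type*} [Fintype X] (r : X → X → Prop) (y z : X → ℝ) (x : X) :
    classSum r (fun x => y x + z x) x = classSum r y x + classSum r z x := by
  unfold classSum
  rw [← Finset.sum_add_distrib]
  exact Finset.sum_congr rfl fun _ _ => by split_ifs <;> simp

theorem classSum_mono {X : Type*} [Fintype X] (r : X → X → Prop) {y z : X → ℝ}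
    (h : ∀ x, y x ≤ z x) (x : X) : classSum r y x ≤ classSum r z x :=
  Finset.sum_le_sum fun _ _ => by split_ifs <;> simp [h]

theorem classSum_nonneg {X : Type*} [Fintype X] (r : X → X → Prop) {y : X → ℝ}
    (h : ∀ x, 0 ≤ y x) (x : X) : 0 ≤ classSum r y x :=
  Finset.sum_nonneg fun _ _ => by split_ifs <;> simp [h]

/-- The weight carried by points whose class is saturated for some `j` is controlled by the
weight that saturates. -/
theorem saturated_weight_le {X 𝒥 : Type*} [Fintype X] [Fintype 𝒥] (r : 𝒥 → X → X → Prop)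
    (hsymm : ∀ j x x', r j x x' → r j x' x) (κ : 𝒥 → ℝ) (hκ : ∀ j, 0 < κ j)
    (W y : X → ℝ) (hW : ∀ x, 0 ≤ W x) (hy : ∀ x, 0 ≤ y x) (q : ℝ)
    (hq : ∀ x, ∑ j, classSum (r j) W x / κ j ≤ q) :
    (∑ x, if ∃ j, κ j ≤ classSum (r j) y x then W x else 0) ≤ q * ∑ x, y x := by
  calc (∑ x, if ∃ j, κ j ≤ classSum (r j) y x then W x else 0)
      ≤ ∑ x, ∑ j, W x * (classSum (r j) y x / κ j) := by
        refine Finset.sum_le_sum fun x _ => ?_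
        have hnn : ∀ j, 0 ≤ W x * (classSum (r j) y x / κ j) := fun j =>
          mul_nonneg (hW x) (div_nonneg (classSum_nonneg _ hy x) (hκ j).le)
        split_ifs with h
        · obtain ⟨j, hj⟩ := h
          calc W x ≤ W x * (classSum (r j) y x / κ j) :=
                le_mul_of_one_le_right (hW x) ((one_le_div (hκ j)).2 hj)
            _ ≤ _ := Finset.single_le_sum (fun j _ => hnn j) (Finset.mem_univ j)
        · exact Finset.sum_nonneg fun j _ => hnn j
    -- Double counting: symmetry of `r j` lets `W` and `y` exchange their roles.
    _ = ∑ x, y x * ∑ j, classSum (r j) W x / κ j := by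
        rw [Finset.sum_comm]
        simp only [Finset.mul_sum]
        rw [Finset.sum_comm (s := (Finset.univ : Finset X))]
        refine Finset.sum_congr rfl fun j _ => ?_
        simp only [classSum, div_eq_mul_inv, Finset.sum_mul, Finset.mul_sum]
        rw [Finset.sum_comm]
        refine Finset.sum_congr rfl fun x _ => Finset.sum_congr rfl fun x' _ => ?_
        by_cases h : r j x' x
        · rw [if_pos h, if_pos (hsymm _ _ _ h)]; ring
        · rw [if_neg h, if_neg fun h' => h (hsymm _ _ _ h')]; ring
    _ ≤ ∑ x, y x * q :=
        Finset.sum_le_sum fun x _ => mul_le_mul_of_nonneg_left (hq x) (hy x)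
    _ = q * ∑ x, y x := by rw [← Finset.sum_mul, mul_comm]

/-- One round of the container algorithm: query vertices of large residual degree, and collect the
(truncated) links of those that are found.  Either many vertices are rejected, or the collected
links form a dense weight with controlled degrees. -/
theorem exists_link_query_aux {β X 𝒥 : Type*} [Fintype β] [Fintype X] [Fintype 𝒥]
    (r : 𝒥 → X → X → Prop) (hr : ∀ j, Equivalence (r j))
    (κ μ : 𝒥 → ℝ) (hκ : ∀ j, 0 < κ j) (w : β → X → ℝ) (hw : ∀ v x, 0 ≤ w v x) (q Δ θ : ℝ)
    (hq0 : 0 ≤ q) (hΔ0 : 0 ≤ Δ) (hθ : 0 < θ)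
    (hq : ∀ x, ∑ j, classSum (r j) (fun x => ∑ v, w v x) x / κ j ≤ q)
    (hΔ : ∀ v, ∑ x, w v x ≤ Δ) (hμ : ∀ j v x, classSum (r j) (w v) x ≤ μ j) (b : ℕ) :
    ∀ (U Sel R : Finset β) (y : X → ℝ), U ∪ Sel ∪ R = Finset.univ → Sel.card ≤ b →
      (∀ x, 0 ≤ y x) → (∀ x, 0 < y x → ∃ v ∈ Sel, 0 < w v x) →
      (Sel.card * θ ≤ ∑ x, y x) → (∑ x, y x ≤ Sel.card * Δ) →
      (∀ j x, classSum (r j) y x ≤ κ j + μ j) → (∀ v ∈ R, ∃ x, 0 < w v x) →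
      Disjoint Sel U →
      ∃ (T : Finset β → Finset β) (out : Finset β → Finset β ⊕ (X → ℝ)), IsQuery T out ∧
        ∀ S, Disjoint R S → Sel ⊆ S → (T S).card + Sel.card ≤ b ∧
          (∀ D, out S = Sum.inl D → Disjoint D S ∧ (∀ v ∈ D, ∃ x, 0 < w v x) ∧
            ∑ v, ∑ x, w v x ≤ D.card * Δ + b * Δ + q * (b * Δ) + Fintype.card β * θ) ∧
          (∀ z, out S = Sum.inr z → (∀ x, 0 ≤ z x) ∧ (∀ x, 0 < z x → ∃ v ∈ S, 0 < w v x) ∧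
            b * θ ≤ ∑ x, z x ∧ ∀ j x, classSum (r j) z x ≤ κ j + μ j) := by
  -- Here `Sel` holds the queried vertices found in `S`, `R` those not found, and `U` those not yet
  -- queried; `y` accumulates the truncated links of `Sel`.
  intro U
  induction U using Finset.strongInduction with
  | H U ih =>
  intro Sel R y hcov hcard hy hsupp hlow hup hdeg hR hdisj
  by_cases hb : Sel.card = b
  · refine ⟨_, _, IsQuery.pure (Sum.inr y), fun S _ hS => ⟨by simp [hb], by simp, ?_⟩⟩
    rintro z hz
    obtain rfl : y = z := by simpa using hz
    exact ⟨hy, fun x hx => (hsupp x hx).imp fun v hv => ⟨hS hv.1, hv.2⟩, hb ▸ hlow, hdeg⟩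
  -- Dead points receive no further weight, so a class exceeds `κ j` by at most the contribution `μ
  -- j` of one link.
  set dead : X → Prop := fun x => ∃ j, κ j ≤ classSum (r j) y x with hdead
  by_cases hex : ∃ v ∈ U, θ ≤ ∑ x, if dead x then 0 else w v x
  · obtain ⟨v, hvU, hv⟩ := hex
    have hss : U.erase v ⊂ U := Finset.erase_ssubset hvU
    have hvSel : v ∉ Sel := fun h => Finset.disjoint_left.1 hdisj h hvU
    have hwle : ∀ x, (if dead x then 0 else w v x) ≤ w v x := fun x => by
      split_ifs
      exacts [hw v x, le_rfl]
    have hwnn : ∀ x, 0 ≤ (if dead x then 0 else w v x) := fun x => by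
      split_ifs
      exacts [le_rfl, hw v x]
    have hcard' : (insert v Sel).card ≤ b := by
      rw [Finset.card_insert_of_notMem hvSel]; omega
    have hΔ0 : ∑ x, (if dead x then 0 else w v x) ≤ Δ :=
      (Finset.sum_le_sum fun x _ => hwle x).trans (hΔ v)
    obtain ⟨T1, o1, hq1, h1⟩ := ih _ hss (insert v Sel) R
      (fun x => y x + if dead x then 0 else w v x)
      (by
        rw [← hcov]; ext z; by_cases hz : z = v
        · subst hz; simp [hvU]
        · simp [hz])
      hcard' (fun x => add_nonneg (hy x) (hwnn x))
      (by
        intro x hx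
        by_cases h0 : 0 < y x
        · exact (hsupp x h0).imp fun u hu => ⟨Finset.mem_insert_of_mem hu.1, hu.2⟩
        · exact ⟨v, Finset.mem_insert_self _ _, by linarith [hwle x]⟩)
      (by
        rw [Finset.card_insert_of_notMem hvSel, Finset.sum_add_distrib]
        push_cast; linarith)
      (by
        rw [Finset.card_insert_of_notMem hvSel, Finset.sum_add_distrib]
        push_cast; linarith)
      (by
        intro j x
        rw [classSum_add]
        by_cases hd : κ j ≤ classSum (r j) y x
        · have : classSum (r j) (fun x => if dead x then 0 else w v x) x = 0 := by
            refine Finset.sum_eq_zero fun x' _ => ?_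
            split_ifs with hr1
            · refine if_pos ⟨j, ?_⟩
              convert hd using 1
              refine Finset.sum_congr rfl fun z _ => ?_
              have : r j x' z ↔ r j x z :=
                ⟨fun h => (hr j).trans hr1 h, fun h => (hr j).trans ((hr j).symm hr1) h⟩
              simp only [this]
            · rfl
          rw [this, add_zero]; exact hdeg j x
        · have := (classSum_mono (r j) hwle x).trans (hμ j v x)
          linarith)
      hR
      (by
        rw [Finset.disjoint_left] at hdisj ⊢
        intro z hz hz'
        rcases Finset.mem_insert.1 hz with rfl | hz
        · simp at hz'
        · exact hdisj hz (Finset.mem_of_mem_erase hz'))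
    obtain ⟨T2, o2, hq2, h2⟩ := ih _ hss Sel (insert v R) y
      (by
        rw [← hcov]; ext z; by_cases hz : z = v
        · subst hz; simp [hvU]
        · simp [hz])
      hcard hy hsupp hlow hup hdeg
      (by
        intro u hu
        rcases Finset.mem_insert.1 hu with rfl | hu
        -- Only vertices of residual degree at least `θ > 0` are queried, so a rejected vertex has a
        -- nonzero link.
        · by_contra! hcon
          have : ∑ x, (if dead x then 0 else w u x) ≤ 0 :=
            Finset.sum_nonpos fun x _ => (hwle x).trans (hcon x)
          linarith
        · exact hR u hu)
      (hdisj.mono_right (Finset.erase_subset _ _))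
    refine ⟨_, _, (IsQuery.ask v).bind (T' := fun a => if a then T1 else T2)
      (out' := fun a => if a then o1 else o2) (by rintro (_ | _); exacts [hq2, hq1]), ?_⟩
    intro S hRS hSel
    by_cases hvS : v ∈ S
    · have hS := h1 S hRS (Finset.insert_subset hvS hSel)
      simp only [hvS, decide_true, if_true]
      refine ⟨?_, hS.2⟩
      have h3 := hS.1
      rw [Finset.card_insert_of_notMem hvSel] at h3
      have h4 := Finset.card_union_le (S ∩ {v}) (T1 S)
      have h5 : (S ∩ {v}).card ≤ 1 :=
        (Finset.card_le_card Finset.inter_subset_right).trans (by simp)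
      omega
    · have hS := h2 S (by simp [hvS, hRS]) hSel
      simpa [hvS] using hS
  · push Not at hex
    refine ⟨_, _, IsQuery.pure (Sum.inl R), fun S hRS hS => ⟨by simpa using hcard, ?_, by simp⟩⟩
    rintro D hD
    obtain rfl : R = D := by simpa using hD
    refine ⟨hRS, hR, ?_⟩
    -- Now every unqueried vertex has residual degree below `θ`. The total weight is thus paid by
    -- `R` and `Sel` at `Δ` per vertex, by `θ` per vertex, and by the dead points, which are few by
    -- double counting.
    have hdeadsum := saturated_weight_le r (fun j x x' h => (hr j).symm h) κ hκ
      (fun x => ∑ v, w v x) y (fun x => Finset.sum_nonneg fun v _ => hw v x) hy q hq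
    have hle : ∀ v ∈ (Finset.univ : Finset β), ∑ x, w v x ≤ (if v ∈ R then Δ else 0) +
        (if v ∈ Sel then Δ else 0) + θ + ∑ x, if dead x then w v x else 0 := by
      intro v _
      have hnn : 0 ≤ ∑ x, if dead x then w v x else 0 :=
        Finset.sum_nonneg fun x _ => by split_ifs; exacts [hw v x, le_rfl]
      have : v ∈ U ∪ Sel ∪ R := hcov ▸ Finset.mem_univ v
      by_cases h1 : v ∈ R
      · have := hΔ v
        simp only [h1, if_true]; split_ifs <;> linarith
      by_cases h2 : v ∈ Sel
      · have := hΔ v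
        simp only [h1, h2, if_true, if_false]; linarith
      have h3 : v ∈ U := by simpa [h1, h2] using this
      have h4 : ∑ x, w v x = (∑ x, if dead x then 0 else w v x) +
          ∑ x, if dead x then w v x else 0 := by
        rw [← Finset.sum_add_distrib]
        exact Finset.sum_congr rfl fun x _ => by split_ifs <;> simp
      have := hex v h3
      simp only [h1, h2, if_false]; linarith
    have h5 := Finset.sum_le_sum hle
    rw [Finset.sum_add_distrib, Finset.sum_add_distrib, Finset.sum_add_distrib] at h5
    have h6 : (∑ v, ∑ x, if dead x then w v x else 0) =
        ∑ x, if dead x then ∑ v, w v x else 0 := by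
      rw [Finset.sum_comm]
      exact Finset.sum_congr rfl fun x _ => by split_ifs <;> simp
    rw [h6] at h5
    simp only [Finset.sum_ite_mem, Finset.univ_inter, Finset.sum_const, nsmul_eq_mul,
      Finset.card_univ] at h5
    have h7 : (Sel.card : ℝ) * Δ ≤ b * Δ :=
      mul_le_mul_of_nonneg_right (by exact_mod_cast hcard) hΔ0
    have h8 : q * ∑ x, y x ≤ q * (b * Δ) :=
      mul_le_mul_of_nonneg_left (hup.trans h7) hq0
    linarith

/-! ### The container theorem -/

/-- Two tuples agree on the coordinates in `J`. -/
def AgreeOn {k : ℕ} {β : Type*} (J : Finset (Fin k)) (x x' : Fin k → β) : Prop :=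
  ∀ j ∈ J, x j = x' j

theorem agreeOn_equivalence {k : ℕ} {β : Type*} (J : Finset (Fin k)) :
    Equivalence (AgreeOn (β := β) J) :=
  ⟨fun _ _ _ => rfl, fun h j hj => (h j hj).symm, fun h h' j hj => (h j hj).trans (h' j hj)⟩

theorem sum_cons {k : ℕ} {β : Type*} [Fintype β] (g : (Fin (k + 1) → β) → ℝ) :
    ∑ x, g x = ∑ v, ∑ x : Fin k → β, g (Fin.cons v x) := by
  rw [← Fintype.sum_prod_type', ← Equiv.sum_comp (Fin.consEquiv fun _ => β)]
  rfl

/-- Index sets avoiding the first coordinate measure degrees in the sum of all links; this controls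
the weight on dead points. -/
theorem classSum_map_succ {k : ℕ} {β : Type*} [Fintype β] (w : (Fin (k + 1) → β) → ℝ)
    (J : Finset (Fin k)) (v : β) (x : Fin k → β) :
    classSum (AgreeOn (J.map (Fin.succEmb k))) w (Fin.cons v x) =
      classSum (AgreeOn J) (fun x => ∑ v, w (Fin.cons v x)) x := by
  unfold classSum
  rw [sum_cons, Finset.sum_comm]
  refine Finset.sum_congr rfl fun x' _ => ?_
  have h : ∀ u, AgreeOn (J.map (Fin.succEmb k)) (Fin.cons v x : Fin (k + 1) → β) (Fin.cons u x') ↔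
      AgreeOn J x x' := fun u => by simp [AgreeOn]
  by_cases h' : AgreeOn J x x' <;> simp [h, h']

/-- Index sets containing the first coordinate measure degrees in a single link; this bounds one
contribution to the collected weight. -/
theorem classSum_insert_zero {k : ℕ} {β : Type*} [Fintype β] (w : (Fin (k + 1) → β) → ℝ)
    (J : Finset (Fin k)) (v : β) (x : Fin k → β) :
    classSum (AgreeOn (insert 0 (J.map (Fin.succEmb k)))) w (Fin.cons v x) =
      classSum (AgreeOn J) (fun x => w (Fin.cons v x)) x := by
  unfold classSum
  rw [sum_cons, Finset.sum_eq_single v]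
  · refine Finset.sum_congr rfl fun x' _ => ?_
    have h : AgreeOn (insert 0 (J.map (Fin.succEmb k))) (Fin.cons v x : Fin (k + 1) → β)
        (Fin.cons v x') ↔ AgreeOn J x x' := by simp [AgreeOn]
    by_cases h' : AgreeOn J x x' <;> simp [h, h']
  · intro u _ hu
    refine Finset.sum_eq_zero fun x' _ => if_neg fun h => hu ?_
    simpa using (h 0 (by simp)).symm
  · simp

/-- One step of the container algorithm: a small part of an independent set determines a large set
which is disjoint from it. -/
theorem exists_container_step (k : ℕ) : ∀ K : ℝ, 0 < K → ∃ c : ℝ, 0 < c ∧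
    ∀ {β : Type u} [Fintype β] (b : ℕ), 1 ≤ b → b ≤ c * Fintype.card β →
    ∀ w : (Fin k → β) → ℝ, (∀ x, 0 ≤ w x) → 0 < ∑ x, w x →
    (∀ J : Finset (Fin k), J.Nonempty → ∀ x, classSum (AgreeOn J) w x ≤
      K * ((b : ℝ) / Fintype.card β) ^ (J.card - 1) * ((∑ x, w x) / Fintype.card β)) →
    ∃ (T : Finset β → Finset β) (D : Finset β → Finset β), IsQuery T D ∧
      ∀ S, (∀ x, 0 < w x → ∃ i, x i ∉ S) → (T S).card ≤ k * b ∧ Disjoint (D S) S ∧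
        c * Fintype.card β ≤ (D S).card ∧ ∀ v ∈ D S, ∃ x, 0 < w x ∧ ∃ i, x i = v := by
  induction k with
  | zero =>
    intro K _
    refine ⟨1, one_pos, fun b _ _ w _ hw _ => ⟨_, _, IsQuery.pure ∅, fun S hS => ?_⟩⟩
    -- The empty tuple has positive weight and no coordinate outside `S`, so no `S` satisfies the
    -- hypothesis.
    obtain ⟨x, _, hx⟩ := Finset.exists_lt_of_sum_lt (s := Finset.univ) (f := fun _ => (0 : ℝ))
      (g := w) (by simpa using hw)
    exact (hS x hx).elim fun i _ => i.elim0
  | succ k ih =>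
    intro K hK
    -- Chosen so that dead points carry at most `W / 4`: this is the identity `e3` below.
    set K1 : ℝ := 4 * 2 ^ k * K ^ 2 with hK1
    have hK1p : 0 < K1 := by positivity
    -- The collected weight has degrees at most `(K1 + K) p ^ |J| (W / N)` and total at least `p W /
    -- 4`, whence the constant for the next uniformity.
    obtain ⟨c', hc', ih⟩ := ih (4 * (K1 + K)) (by positivity)
    refine ⟨min c' (1 / (4 * K)), by positivity, ?_⟩
    intro β _ b hb hbc w hw hW hdeg
    set W := ∑ x, w x with hWdef
    set N : ℝ := (Fintype.card β : ℝ) with hN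
    have hb' : (0 : ℝ) < b := by exact_mod_cast hb
    have hN0 : 0 < N := by
      by_contra! h
      have : min c' (1 / (4 * K)) * N ≤ 0 := mul_nonpos_of_nonneg_of_nonpos (by positivity) h
      linarith
    set p : ℝ := b / N with hp
    have hp0 : 0 < p := by positivity
    have hbp : (b : ℝ) = p * N := by rw [hp]; field_simp
    have hpK : p * K ≤ 1 / 4 := by
      have : p ≤ 1 / (4 * K) := by
        rw [hp, div_le_iff₀ hN0]
        exact hbc.trans (mul_le_mul_of_nonneg_right (min_le_right _ _) hN0.le)
      calc p * K ≤ 1 / (4 * K) * K := mul_le_mul_of_nonneg_right this hK.le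
        _ = 1 / 4 := by field_simp
    have hpos : Nonempty β := by
      by_contra h
      rw [not_nonempty_iff] at h
      simp [hN] at hN0
    obtain ⟨v₀⟩ := hpos
    let r : {J : Finset (Fin k) // J.Nonempty} → (Fin k → β) → (Fin k → β) → Prop :=
      fun J => AgreeOn J.1
    have hWsum : ∑ v, ∑ x, w (Fin.cons v x) = W := (sum_cons w).symm
    have hΔ : ∀ v, ∑ x, w (Fin.cons v x) ≤ K * (W / N) := by
      intro v
      have h1 := hdeg (insert 0 ((∅ : Finset (Fin k)).map (Fin.succEmb k))) (by simp)
        (Fin.cons v fun _ => v)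
      rw [classSum_insert_zero] at h1
      simpa [classSum, AgreeOn] using h1
    have hμ : ∀ (J : {J : Finset (Fin k) // J.Nonempty}) v x,
        classSum (r J) (fun x => w (Fin.cons v x)) x ≤ K * p ^ J.1.card * (W / N) := by
      intro J v x
      have h1 := hdeg (insert 0 (J.1.map (Fin.succEmb k))) (by simp) (Fin.cons v x)
      rw [classSum_insert_zero, Finset.card_insert_of_notMem (by simp)] at h1
      simpa using h1
    have hq : ∀ x, ∑ J, classSum (r J) (fun x => ∑ v, w (Fin.cons v x)) x /
        (K1 * p ^ J.1.card * (W / N)) ≤ 2 ^ k * (K / (K1 * p)) := by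
      intro x
      have h1 : ∀ J ∈ (Finset.univ : Finset {J : Finset (Fin k) // J.Nonempty}),
          classSum (r J) (fun x => ∑ v, w (Fin.cons v x)) x /
            (K1 * p ^ J.1.card * (W / N)) ≤ K / (K1 * p) := by
        intro J _
        have h1 := hdeg (J.1.map (Fin.succEmb k)) (by simpa using J.2) (Fin.cons v₀ x)
        rw [classSum_map_succ, Finset.card_map] at h1
        rw [div_le_iff₀ (by positivity)]
        refine h1.trans (le_of_eq ?_)
        obtain ⟨j, hj⟩ := Nat.exists_eq_succ_of_ne_zero J.2.card_ne_zero
        rw [hj, Nat.succ_sub_one, Nat.succ_eq_add_one, pow_succ]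
        field_simp
      refine (Finset.sum_le_card_nsmul _ _ _ h1).trans ?_
      rw [nsmul_eq_mul]
      refine mul_le_mul_of_nonneg_right ?_ (by positivity)
      rw [Finset.card_univ]
      have := Fintype.card_subtype_le fun J : Finset (Fin k) => J.Nonempty
      simp only [Fintype.card_finset, Fintype.card_fin] at this
      exact_mod_cast this
    obtain ⟨T1, o1, hq1, h1⟩ := exists_link_query_aux r (fun J => agreeOn_equivalence J.1)
      (fun J => K1 * p ^ J.1.card * (W / N)) (fun J => K * p ^ J.1.card * (W / N))
      (fun J => by positivity) (fun v x => w (Fin.cons v x)) (fun v x => hw _)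
      (2 ^ k * (K / (K1 * p))) (K * (W / N)) (W / (4 * N)) (by positivity) (by positivity)
      (by positivity) hq hΔ hμ b Finset.univ ∅ ∅ 0 (by simp) (by simp) (by simp) (by simp)
      (by simp) (by simp)
      (fun j x => by
        have : classSum (r j) 0 x = 0 := by simp [classSum]
        rw [this]; positivity)
      (by simp) (by simp)
    -- Composing queries needs a second query for every conceivable output of the first; weights
    -- violating the guarantees get the trivial one.
    have h2 : ∀ o : Finset β ⊕ ((Fin k → β) → ℝ), ∃ (T : Finset β → Finset β)
        (D : Finset β → Finset β), IsQuery T D ∧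
        (∀ D₀, o = Sum.inl D₀ → ∀ S, T S = ∅ ∧ D S = D₀) ∧
        ∀ z, o = Sum.inr z → (∀ x, 0 ≤ z x) → b * (W / (4 * N)) ≤ ∑ x, z x →
          (∀ J x, classSum (r J) z x ≤ K1 * p ^ J.1.card * (W / N) + K * p ^ J.1.card * (W / N)) →
          ∀ S, (∀ x, 0 < z x → ∃ i, x i ∉ S) → (T S).card ≤ k * b ∧ Disjoint (D S) S ∧
            c' * N ≤ (D S).card ∧ ∀ v ∈ D S, ∃ x, 0 < z x ∧ ∃ i, x i = v := by
      rintro (D₀ | z)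
      · exact ⟨_, _, IsQuery.pure D₀, by simp, by simp⟩
      · by_cases hz : (∀ x, 0 ≤ z x) ∧ b * (W / (4 * N)) ≤ ∑ x, z x ∧ ∀ J x, classSum (r J) z x ≤
          K1 * p ^ J.1.card * (W / N) + K * p ^ J.1.card * (W / N)
        · obtain ⟨hz0, hzW, hzd⟩ := hz
          have hzpos : 0 < ∑ x, z x := lt_of_lt_of_le (by positivity) hzW
          obtain ⟨T, D, hTD, h⟩ := ih b hb (hbc.trans
            (mul_le_mul_of_nonneg_right (min_le_left _ _) hN0.le)) z hz0 hzpos (by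
              intro J hJ x
              refine (hzd ⟨J, hJ⟩ x).trans ?_
              obtain ⟨j, hj⟩ := Nat.exists_eq_succ_of_ne_zero hJ.card_ne_zero
              simp only [hj, Nat.succ_sub_one, Nat.succ_eq_add_one, pow_succ]
              have h3 : p * W ≤ 4 * ∑ x, z x := by
                rw [hbp] at hzW
                have : p * N * (W / (4 * N)) = p * W / 4 := by field_simp
                linarith
              calc K1 * (p ^ j * p) * (W / N) + K * (p ^ j * p) * (W / N)
                  = (K1 + K) * p ^ j * (p * W) / N := by ring
                _ ≤ (K1 + K) * p ^ j * (4 * ∑ x, z x) / N := by gcongr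
                _ = 4 * (K1 + K) * p ^ j * ((∑ x, z x) / N) := by ring)
          refine ⟨T, D, hTD, by simp, ?_⟩
          rintro z' hz' - - -
          obtain rfl : z = z' := by simpa using hz'
          exact h
        · refine ⟨_, _, IsQuery.pure ∅, by simp, ?_⟩
          rintro z' hz' h3 h4 h5
          obtain rfl : z = z' := by simpa using hz'
          exact absurd ⟨h3, h4, h5⟩ hz
    choose T2 D2 hq2 hinl hinr using h2
    refine ⟨_, _, hq1.bind hq2, ?_⟩
    intro S hS
    obtain ⟨hc1, hl1, hr1⟩ := h1 S (by simp) (by simp)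
    simp only [Finset.card_empty, add_zero] at hc1
    have hcu := Finset.card_union_le (T1 S) (T2 (o1 S) S)
    rcases ho : o1 S with D₀ | z
    · obtain ⟨e1, e2⟩ := hinl _ D₀ ho S
      rw [ho] at e1 e2 hcu
      obtain ⟨g1, g2, g3⟩ := hl1 D₀ ho
      rw [e1, e2]
      refine ⟨?_, g1, ?_, ?_⟩
      · rw [Finset.union_empty]; nlinarith
      · rw [hWsum] at g3
        -- Selected vertices, dead points and low residual degrees account for at most a quarter of
        -- `W` each, so the rejected vertices carry the last quarter.
        have e3 : 2 ^ k * (K / (K1 * p)) * (b * (K * (W / N))) = W / 4 := by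
          rw [hbp, hK1]; field_simp
        have e4 : N * (W / (4 * N)) = W / 4 := by field_simp
        have e5 : (b : ℝ) * (K * (W / N)) = p * K * W := by rw [hbp]; field_simp
        have e6 : p * K * W ≤ 1 / 4 * W := mul_le_mul_of_nonneg_right hpK hW.le
        rw [e3, e4, e5] at g3
        have e7 : W / 4 ≤ D₀.card * (K * (W / N)) := by linarith
        have e8 : D₀.card * (K * (W / N)) = (D₀.card * K / N) * W := by ring
        rw [e8] at e7
        have e9 : 1 / 4 ≤ D₀.card * K / N := by
          by_contra! hlt
          have := mul_lt_mul_of_pos_right hlt hW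
          linarith
        rw [le_div_iff₀ hN0] at e9
        calc min c' (1 / (4 * K)) * N ≤ 1 / (4 * K) * N := by gcongr; exact min_le_right _ _
          _ = (1 / 4 * N) / K := by field_simp
          _ ≤ D₀.card := by rw [div_le_iff₀ hK]; exact e9
      · intro v hv
        obtain ⟨x, hx⟩ := g2 v hv
        exact ⟨_, hx, 0, by simp⟩
    · obtain ⟨g1, g2, g3, g4⟩ := hr1 z ho
      obtain ⟨f1, f2, f3, f4⟩ := hinr _ z ho g1 g3 g4 S (by
        -- A point of the collected weight extends by some `v ∈ S` to a tuple of positive weight, so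
        -- a coordinate outside `S` is among the remaining ones.
        intro x hx
        obtain ⟨v, hv, hvx⟩ := g2 x hx
        obtain ⟨i, hi⟩ := hS _ hvx
        refine Fin.cases (fun h => absurd hv (by simpa using h)) (fun i h => ⟨i, by simpa using h⟩) i hi)
      rw [ho] at f1 f2 f3 f4 hcu
      refine ⟨?_, f2, ?_, ?_⟩
      · have : (k + 1) * b = b + k * b := by ring
        omega
      · exact (mul_le_mul_of_nonneg_right (min_le_left _ _) hN0.le).trans f3
      · intro v hv
        obtain ⟨x, hx, i, hi⟩ := f4 v hv
        obtain ⟨u, _, hu⟩ := g2 x hx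
        exact ⟨_, hu, i.succ, by simpa using hi⟩

theorem card_filter_le_classSum {k : ℕ} {β Φ : Type*} [Fintype β] [DecidableEq β] [Fintype Φ]
    (f : Φ → Fin k → β) (C : Finset β) (J : Finset (Fin k)) (x : Fin k → β) :
    classSum (AgreeOn J)
      (fun x => ∑ φ : Φ, if f φ = x ∧ ∀ i, x i ∈ C then (1 : ℝ) else 0) x ≤
      (Finset.univ.filter fun φ => AgreeOn J x (f φ)).card := by
  unfold classSum
  have h : ∀ x', (if AgreeOn J x x' then ∑ φ : Φ, if f φ = x' ∧ ∀ i, x' i ∈ C then (1 : ℝ) else 0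
      else 0) ≤ ∑ φ : Φ, if f φ = x' then (if AgreeOn J x (f φ) then (1 : ℝ) else 0) else 0 := by
    intro x'
    split_ifs with h1
    · refine Finset.sum_le_sum fun φ _ => ?_
      by_cases h2 : f φ = x'
      · subst h2
        simp only [h1, if_true, true_and]
        split_ifs <;> norm_num
      · simp [h2]
    · exact Finset.sum_nonneg fun φ _ => by split_ifs <;> norm_num
  refine (Finset.sum_le_sum fun x' _ => h x').trans ?_
  rw [Finset.sum_comm]
  simp

/-- The container theorem in the form used here: all sets that contain no tuple `f φ` lie in
containers with few such tuples, and each container is determined by a small subset. -/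
theorem exists_container (k : ℕ) (L δ : ℝ) (hL : 0 < L) (hδ : 0 < δ) : ∃ c : ℝ, 0 < c ∧ ∃ r : ℕ,
    ∀ {β : Type u} {Φ : Type u} [Fintype β] [DecidableEq β] [Fintype Φ] [Nonempty Φ] (b : ℕ), 1 ≤ b →
    b ≤ c * Fintype.card β → ∀ f : Φ → Fin k → β,
    (∀ J : Finset (Fin k), J.Nonempty → ∀ x,
      ((Finset.univ.filter fun φ => AgreeOn J x (f φ)).card : ℝ) ≤
      L * ((b : ℝ) / Fintype.card β) ^ (J.card - 1) * (Fintype.card Φ / Fintype.card β)) →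
    ∃ (T : Finset β → Finset β) (C : Finset β → Finset β), IsQuery T C ∧
      ∀ S, (∀ φ, ∃ i, f φ i ∉ S) → (T S).card ≤ r * b ∧ S ⊆ C S ∧
        ((Finset.univ.filter fun φ => ∀ i, f φ i ∈ C S).card : ℝ) < δ * Fintype.card Φ := by
  -- While at least `δ |Φ|` tuples survive, degree bounds relative to the surviving weight worsen
  -- only by the factor `1 / δ`.
  obtain ⟨c, hc, hstep⟩ := exists_container_step.{u} k (L / δ) (by positivity)
  refine ⟨c, hc, ⌈1 / c⌉₊ * k, ?_⟩
  intro β Φ _ _ _ _ b hb hbc f hf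
  have hΦ : (0 : ℝ) < Fintype.card Φ := by exact_mod_cast Fintype.card_pos
  have hN0 : 0 < (Fintype.card β : ℝ) := by
    have : (0 : ℝ) < b := by exact_mod_cast hb
    by_contra! h
    have := mul_nonpos_of_nonneg_of_nonpos hc.le h
    linarith
  -- Each round deletes at least `c |β|` points from the candidate `C₀ ⊇ S`, so `⌈1 / c⌉` rounds
  -- suffice.
  have key : ∀ r : ℕ, ∀ C₀ : Finset β, (C₀.card : ℝ) ≤ r * (c * Fintype.card β) →
      ∃ (T : Finset β → Finset β) (C : Finset β → Finset β), IsQuery T C ∧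
      ∀ S, (∀ φ, ∃ i, f φ i ∉ S) → S ⊆ C₀ → (T S).card ≤ r * k * b ∧ S ⊆ C S ∧
        ((Finset.univ.filter fun φ => ∀ i, f φ i ∈ C S).card : ℝ) < δ * Fintype.card Φ := by
    intro r
    induction r with
    | zero =>
      intro C₀ hC₀
      have hC₀ : C₀ = ∅ := by
        have : (C₀.card : ℝ) ≤ 0 := by simpa only [Nat.cast_zero, zero_mul] using hC₀
        exact Finset.card_eq_zero.1 (Nat.le_zero.1 (by exact_mod_cast this))
      refine ⟨_, _, IsQuery.pure C₀, fun S hS hSC => ⟨by simp, hSC, ?_⟩⟩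
      have : (Finset.univ.filter fun φ => ∀ i, f φ i ∈ C₀) = ∅ := by
        refine Finset.filter_eq_empty_iff.2 fun φ _ h => ?_
        obtain ⟨i, _⟩ := hS φ
        simpa [hC₀] using h i
      rw [this]
      simp only [Finset.card_empty, Nat.cast_zero]
      positivity
    | succ r ih =>
      intro C₀ hC₀
      by_cases hlt : ((Finset.univ.filter fun φ => ∀ i, f φ i ∈ C₀).card : ℝ) < δ * Fintype.card Φ
      · exact ⟨_, _, IsQuery.pure C₀, fun S _ hSC => ⟨by simp, hSC, hlt⟩⟩
      push Not at hlt
      set w : (Fin k → β) → ℝ :=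
        fun x => ∑ φ : Φ, if f φ = x ∧ ∀ i, x i ∈ C₀ then (1 : ℝ) else 0 with hw
      have hw0 : ∀ x, 0 ≤ w x := fun x => Finset.sum_nonneg fun φ _ => by split_ifs <;> norm_num
      have hwsupp : ∀ x, 0 < w x → ∃ φ, f φ = x ∧ ∀ i, x i ∈ C₀ := by
        intro x hx
        by_contra! h
        refine hx.ne' (Finset.sum_eq_zero fun φ _ => if_neg fun h' => ?_)
        obtain ⟨i, hi⟩ := h φ h'.1
        exact hi (h'.2 i)
      have hwsum : ∑ x, w x = (Finset.univ.filter fun φ => ∀ i, f φ i ∈ C₀).card := by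
        rw [hw, Finset.sum_comm, Finset.card_filter]
        push_cast
        refine Finset.sum_congr rfl fun φ _ => ?_
        rw [Finset.sum_eq_single (f φ)]
        · simp
        · intro x _ hx; exact if_neg fun h => hx h.1.symm
        · simp
      have hwpos : 0 < ∑ x, w x := by
        rw [hwsum]
        exact lt_of_lt_of_le (by positivity) hlt
      obtain ⟨T, D, hTD, h⟩ := hstep b hb hbc w hw0 hwpos (by
        intro J hJ x
        refine (card_filter_le_classSum f C₀ J x).trans ((hf J hJ x).trans ?_)
        have h1 : (Fintype.card Φ : ℝ) ≤ (∑ x, w x) / δ := by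
          rw [le_div_iff₀ hδ, hwsum, mul_comm]; exact hlt
        calc L * ((b : ℝ) / Fintype.card β) ^ (J.card - 1) * (Fintype.card Φ / Fintype.card β)
            ≤ L * ((b : ℝ) / Fintype.card β) ^ (J.card - 1) *
              ((∑ x, w x) / δ / Fintype.card β) := by gcongr
          _ = _ := by ring)
      have h2 : ∀ D₀ : Finset β, ∃ (T : Finset β → Finset β) (C : Finset β → Finset β),
          IsQuery T C ∧ (((C₀ \ D₀).card : ℝ) ≤ r * (c * Fintype.card β) →
          ∀ S, (∀ φ, ∃ i, f φ i ∉ S) → S ⊆ C₀ \ D₀ → (T S).card ≤ r * k * b ∧ S ⊆ C S ∧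
          ((Finset.univ.filter fun φ => ∀ i, f φ i ∈ C S).card : ℝ) < δ * Fintype.card Φ) := by
        intro D₀
        by_cases hD : (((C₀ \ D₀).card : ℝ) ≤ r * (c * Fintype.card β))
        · obtain ⟨T, C, h1, h2⟩ := ih _ hD
          exact ⟨T, C, h1, fun _ => h2⟩
        · exact ⟨_, _, IsQuery.pure ∅, fun h => absurd h hD⟩
      choose T2 C2 hq2 h2 using h2
      refine ⟨_, _, hTD.bind hq2, fun S hS hSC => ?_⟩
      obtain ⟨g1, g2, g3, g4⟩ := h S (fun x hx => by
        obtain ⟨φ, rfl, _⟩ := hwsupp x hx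
        exact hS φ)
      -- The deleted points lie on tuples inside `C₀`, so the candidate really shrinks.
      have hDC : D S ⊆ C₀ := fun v hv => by
        obtain ⟨x, hx, i, rfl⟩ := g4 v hv
        obtain ⟨φ, _, h⟩ := hwsupp x hx
        exact h i
      obtain ⟨f1, f2, f3⟩ := h2 (D S) (by
        rw [Finset.card_sdiff_of_subset hDC, Nat.cast_sub (Finset.card_le_card hDC)]
        push_cast at hC₀
        linarith) S hS (Finset.subset_sdiff.2 ⟨hSC, g2.symm⟩)
      refine ⟨(Finset.card_union_le _ _).trans ?_, f2, f3⟩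
      calc (T S).card + (T2 (D S) S).card ≤ k * b + r * k * b := Nat.add_le_add g1 f1
        _ = (r + 1) * k * b := by ring
  obtain ⟨T, C, hTC, h⟩ := key ⌈1 / c⌉₊ Finset.univ (by
    rw [Finset.card_univ, ← mul_assoc]
    refine le_mul_of_one_le_left hN0.le ?_
    rw [← div_le_iff₀ hc]
    exact Nat.le_ceil _)
  exact ⟨T, C, hTC, fun S hS => h S hS (Finset.subset_univ _)⟩

/-! ### Greedy embedding into dense boxes -/

/-- The maps `φ` with values in the box `Y` that respect all relations `R a b`, `a < b` in `U`. -/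
noncomputable def partialCopies {V α : Type*} [Fintype V] [LinearOrder V] [Fintype α] [DecidableEq α]
    (E : V → V → Prop) (R : V → V → Finset (α × α)) (U : Finset V) (Y : V → Finset α) :
    Finset (V → α) :=
  (Fintype.piFinset Y).filter fun φ =>
    ∀ a ∈ U, ∀ b ∈ U, a < b → E a b → (φ a, φ b) ∈ R a b

/-- If all pairs of large subsets of a box are dense, then the box contains many copies. -/
theorem card_partialCopies_ge {V α : Type*} [Fintype V] [LinearOrder V] [Fintype α] [DecidableEq α]
    (E : V → V → Prop) (R : V → V → Finset (α × α)) (δ : ℝ) (hδ : 0 < δ) (hδ1 : δ ≤ 1)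
    (Y : V → Finset α) (hY : ∀ v, (Y v).Nonempty)
    (hR : ∀ a b, a < b → E a b → ∀ X ⊆ Y a, ∀ X' ⊆ Y b,
      δ ^ Fintype.card V / (2 * Fintype.card V) * (Y a).card ≤ X.card →
      δ ^ Fintype.card V / (2 * Fintype.card V) * (Y b).card ≤ X'.card →
      δ * X.card * X'.card ≤ (R a b ∩ X ×ˢ X').card) (U : Finset V) :
    ∀ Z : V → Finset α, (∀ v ∈ U, Z v ⊆ Y v) →
      (∀ v ∈ U, δ ^ (Fintype.card V - U.card) * (Y v).card ≤ (Z v).card) →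
      (δ ^ Fintype.card V / 2) ^ U.card * ∏ v, ((Z v).card : ℝ) ≤
        (partialCopies E R U Z).card := by
  set v₁ := Fintype.card V with hv₁
  induction U using Finset.induction_on_min with
  | empty =>
    intro Z _ _
    simp [partialCopies, Fintype.card_piFinset]
  | insert u U hlt ih =>
    intro Z hZY hZ
    have huU : u ∉ U := fun h => lt_irrefl _ (hlt u h)
    have hcard : (insert u U).card = U.card + 1 := Finset.card_insert_of_notMem huU
    have hUle : U.card + 1 ≤ v₁ := hcard ▸ Finset.card_le_univ _
    have hv₁0 : (0 : ℝ) < v₁ := by exact_mod_cast (by omega : 0 < v₁)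
    have hpow : ∀ {i : ℕ}, i ≤ v₁ → δ ^ v₁ ≤ δ ^ i := fun h => pow_le_pow_of_le_one hδ.le hδ1 h
    set lam := δ ^ v₁ / (2 * v₁) with hlam
    have hlam0 : 0 < lam := by positivity
    have hlamle : lam ≤ δ ^ v₁ := by
      rw [hlam]
      refine div_le_self (by positivity) ?_
      have : (1 : ℝ) ≤ v₁ := by exact_mod_cast (by omega : 1 ≤ v₁)
      linarith
    let nb : V → α → Finset α := fun v x => (Z v).filter fun y => (x, y) ∈ R u v
    let bad : V → Finset α := fun v => (Z u).filter fun x => ((nb v x).card : ℝ) < δ * (Z v).card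
    have hbad : ∀ v ∈ U, E u v → ((bad v).card : ℝ) ≤ lam * (Y u).card := by
      intro v hv hE
      by_contra! hcon
      have hbY : bad v ⊆ Y u := (Finset.filter_subset _ _).trans (hZY u (by simp))
      have hvZ : lam * (Y v).card ≤ (Z v).card := by
        exact le_trans (mul_le_mul_of_nonneg_right (hlamle.trans (hpow (Nat.sub_le _ _)))
          (by positivity)) (hZ v (by simp [hv]))
      have h1 := hR u v (hlt v hv) hE (bad v) hbY (Z v) (hZY v (by simp [hv])) hcon.le hvZ
      have h2 : ((R u v ∩ bad v ×ˢ Z v).card : ℝ) = ∑ x ∈ bad v, ((nb v x).card : ℝ) := by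
        have : R u v ∩ bad v ×ˢ Z v = ((bad v).sigma fun x => nb v x).map
            (Equiv.sigmaEquivProd α α).toEmbedding := by
          ext ⟨x, y⟩
          simp only [nb, Finset.mem_inter, Finset.mem_product, Finset.mem_map, Finset.mem_sigma,
            Finset.mem_filter]
          constructor
          · rintro ⟨h1, h2, h3⟩
            exact ⟨⟨x, y⟩, ⟨h2, h3, h1⟩, rfl⟩
          · rintro ⟨⟨x', y'⟩, ⟨h2, h3, h1⟩, h⟩
            obtain ⟨rfl, rfl⟩ : x' = x ∧ y' = y := by simpa using h
            exact ⟨h1, h2, h3⟩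
        rw [this, Finset.card_map, Finset.card_sigma]
        push_cast; rfl
      have hne : (bad v).Nonempty := by
        rw [← Finset.card_pos]
        have : (0 : ℝ) < (bad v).card := lt_of_le_of_lt (by positivity) hcon
        exact_mod_cast this
      have h3 : ∑ x ∈ bad v, ((nb v x).card : ℝ) < ∑ x ∈ bad v, δ * (Z v).card :=
        Finset.sum_lt_sum_of_nonempty hne fun x hx => (Finset.mem_filter.1 hx).2
      rw [Finset.sum_const, nsmul_eq_mul, ← h2] at h3
      nlinarith
    set good : Finset α := Z u \ (U.filter fun v => E u v).biUnion bad with hgood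
    -- `lam` is so small that all bad sets together fill at most half of `Z u`.
    have hgoodcard : ((Z u).card : ℝ) / 2 ≤ good.card := by
      have h1 : (((U.filter fun v => E u v).biUnion bad).card : ℝ) ≤ v₁ * (lam * (Y u).card) := by
        calc (((U.filter fun v => E u v).biUnion bad).card : ℝ)
            ≤ ∑ v ∈ U.filter fun v => E u v, ((bad v).card : ℝ) := by
              exact_mod_cast Finset.card_biUnion_le
          _ ≤ ∑ v ∈ U.filter fun v => E u v, lam * (Y u).card :=
              Finset.sum_le_sum fun v hv =>
                hbad v (Finset.mem_filter.1 hv).1 (Finset.mem_filter.1 hv).2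
          _ ≤ v₁ * (lam * (Y u).card) := by
              rw [Finset.sum_const, nsmul_eq_mul]
              gcongr
              exact Finset.card_le_univ _
      have h2 : (v₁ : ℝ) * (lam * (Y u).card) = δ ^ v₁ * (Y u).card / 2 := by
        rw [hlam]; field_simp
      have h3 : δ ^ v₁ * (Y u).card ≤ (Z u).card := by
        exact le_trans (mul_le_mul_of_nonneg_right (hpow (Nat.sub_le _ _)) (by positivity))
          (hZ u (by simp))
      have h4 : ((Z u).card : ℝ) ≤ good.card +
          ((U.filter fun v => E u v).biUnion bad).card := by
        exact_mod_cast Finset.card_le_card_sdiff_add_card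
      linarith
    let Zx : α → V → Finset α := fun x v =>
      if v = u then {x} else if v ∈ U ∧ E u v then nb v x else Z v
    have hZxu : ∀ x, Zx x u = {x} := fun x => if_pos rfl
    have hZxle : ∀ x v, v ≠ u → Zx x v ⊆ Z v := by
      intro x v hv
      simp only [Zx, hv, if_false]
      split_ifs
      exacts [Finset.filter_subset _ _, subset_rfl]
    have hZxge : ∀ x ∈ good, ∀ v, v ≠ u → δ * (Z v).card ≤ (Zx x v).card := by
      intro x hx v hv
      simp only [Zx, hv, if_false]
      split_ifs with h
      · obtain ⟨h1, h2⟩ := Finset.mem_sdiff.1 hx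
        by_contra! hcon
        exact h2 (Finset.mem_biUnion.2 ⟨v, Finset.mem_filter.2 h, Finset.mem_filter.2 ⟨h1, hcon⟩⟩)
      · exact mul_le_of_le_one_left (by positivity) hδ1
    have hP0 : 0 ≤ ∏ v ∈ Finset.univ.erase u, ((Z v).card : ℝ) :=
      Finset.prod_nonneg fun _ _ => Nat.cast_nonneg _
    have hmain : ∀ x ∈ good, (δ ^ v₁ / 2) ^ U.card * (δ ^ v₁ *
        ∏ v ∈ Finset.univ.erase u, ((Z v).card : ℝ)) ≤ (partialCopies E R U (Zx x)).card := by
      intro x hx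
      have hne : ∀ v ∈ U, v ≠ u := fun v hv h => huU (h ▸ hv)
      refine le_trans ?_ (ih (Zx x)
        (fun v hv => (hZxle x v (hne v hv)).trans (hZY v (by simp [hv]))) ?_)
      · refine mul_le_mul_of_nonneg_left ?_ (by positivity)
        rw [← Finset.mul_prod_erase _ _ (Finset.mem_univ u)]
        have h1 : ((Zx x u).card : ℝ) = 1 := by rw [hZxu, Finset.card_singleton, Nat.cast_one]
        rw [h1, one_mul]
        calc δ ^ v₁ * ∏ v ∈ Finset.univ.erase u, ((Z v).card : ℝ)
            ≤ δ ^ (Finset.univ.erase u).card * ∏ v ∈ Finset.univ.erase u, ((Z v).card : ℝ) := by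
              exact mul_le_mul_of_nonneg_right (hpow (Finset.card_le_univ _)) hP0
          _ = ∏ v ∈ Finset.univ.erase u, δ * ((Z v).card : ℝ) := by
              rw [Finset.prod_mul_distrib, Finset.prod_const]
          _ ≤ _ := Finset.prod_le_prod (fun v _ => mul_nonneg hδ.le (Nat.cast_nonneg _))
              fun v hv => hZxge x hx v (Finset.ne_of_mem_erase hv)
      · intro v hv
        refine le_trans ?_ (hZxge x hx v (hne v hv))
        have h1 := hZ v (by simp [hv])
        have h2 : v₁ - U.card = (v₁ - (insert u U).card) + 1 := by omega
        rw [h2, pow_succ]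
        nlinarith
    have hsub : good.biUnion (fun x => partialCopies E R U (Zx x)) ⊆
        partialCopies E R (insert u U) Z := by
      intro φ hφ
      obtain ⟨x, hx, hφ⟩ := Finset.mem_biUnion.1 hφ
      simp only [partialCopies, Finset.mem_filter, Fintype.mem_piFinset] at hφ ⊢
      obtain ⟨h1, h2⟩ := hφ
      have hφu : φ u = x := by simpa [hZxu] using h1 u
      refine ⟨fun v => ?_, ?_⟩
      · by_cases hv : v = u
        · subst hv; rw [hφu]; exact (Finset.mem_sdiff.1 hx).1
        · exact hZxle x v hv (h1 v)
      · intro a ha b hb hab hE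
        have hbU : b ∈ U := by
          rcases Finset.mem_insert.1 hb with rfl | hb
          · rcases Finset.mem_insert.1 ha with rfl | ha
            · exact absurd hab (lt_irrefl _)
            · exact absurd (hlt a ha) hab.not_gt
          · exact hb
        rcases Finset.mem_insert.1 ha with rfl | ha
        · have := h1 b
          simp only [Zx, hab.ne', if_false, hbU, hE, and_self, if_true, nb,
            Finset.mem_filter] at this
          rw [hφu]; exact this.2
        · exact h2 a ha b hbU hab hE
    have hdisj : (good : Set α).PairwiseDisjoint fun x => partialCopies E R U (Zx x) := by
      intro x _ x' _ hne
      refine Finset.disjoint_left.2 fun φ h h' => hne ?_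
      simp only [partialCopies, Finset.mem_filter, Fintype.mem_piFinset] at h h'
      have h1 : φ u = x := by simpa [hZxu] using h.1 u
      have h2 : φ u = x' := by simpa [hZxu] using h'.1 u
      exact h1.symm.trans h2
    have hfin := Finset.card_le_card hsub
    rw [Finset.card_biUnion hdisj] at hfin
    have h5 := Finset.sum_le_sum hmain
    rw [Finset.sum_const, nsmul_eq_mul] at h5
    rw [hcard, ← Finset.mul_prod_erase _ _ (Finset.mem_univ u)]
    have h6 : (0 : ℝ) ≤ (δ ^ v₁ / 2) ^ U.card * (δ ^ v₁ *
        ∏ v ∈ Finset.univ.erase u, ((Z v).card : ℝ)) :=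
      mul_nonneg (by positivity) (mul_nonneg (by positivity) hP0)
    calc (δ ^ v₁ / 2) ^ (U.card + 1) *
          ((Z u).card * ∏ v ∈ Finset.univ.erase u, ((Z v).card : ℝ))
        = ((Z u).card : ℝ) / 2 * ((δ ^ v₁ / 2) ^ U.card * (δ ^ v₁ *
          ∏ v ∈ Finset.univ.erase u, ((Z v).card : ℝ))) := by ring
      _ ≤ good.card * ((δ ^ v₁ / 2) ^ U.card * (δ ^ v₁ *
          ∏ v ∈ Finset.univ.erase u, ((Z v).card : ℝ))) :=
          mul_le_mul_of_nonneg_right hgoodcard h6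
      _ ≤ ∑ x ∈ good, ((partialCopies E R U (Zx x)).card : ℝ) := h5
      _ ≤ _ := by exact_mod_cast hfin

/-! ### Exhausting a box by sparse sub-boxes -/

/-- The number of maps in the box `Y` that send `a` and `b` to a prescribed pair. -/
noncomputable def fiberCard {V α : Type*} [Fintype V] [DecidableEq V] [DecidableEq α] (Y : V → Finset α) (a b : V)
    (q : α × α) : ℝ :=
  ((Fintype.piFinset Y).filter fun φ => φ a = q.1 ∧ φ b = q.2).card

theorem fiberCard_eq {V α : Type*} [Fintype V] [DecidableEq V] [DecidableEq α] (Y : V → Finset α) {a b : V} (hab : a ≠ b)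
    (q : α × α) : fiberCard Y a b q =
      if q ∈ Y a ×ˢ Y b then ∏ v ∈ (Finset.univ.erase a).erase b, ((Y v).card : ℝ) else 0 := by
  have h : ((Fintype.piFinset Y).filter fun φ => φ a = q.1 ∧ φ b = q.2) = Fintype.piFinset
      (fun v => if v = a then Y a ∩ {q.1} else if v = b then Y b ∩ {q.2} else Y v) := by
    ext φ
    simp only [Finset.mem_filter, Fintype.mem_piFinset]
    constructor
    · rintro ⟨h1, h2, h3⟩ v
      split_ifs with hv hv'
      · subst hv; simp [← h2, h1 v]
      · subst hv'; simp [← h3, h1 v]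
      · exact h1 v
    · intro h
      have ha := h a
      have hb := h b
      simp only [if_true, hab.symm, if_false, Finset.mem_inter, Finset.mem_singleton] at ha hb
      refine ⟨fun v => ?_, ha.2, hb.2⟩
      have := h v
      split_ifs at this with hv hv'
      · subst hv; exact ha.1
      · subst hv'; exact hb.1
      · exact this
  have hb : b ∈ Finset.univ.erase a := by simp [hab.symm]
  rw [fiberCard, h, Fintype.card_piFinset, ← Finset.mul_prod_erase _ _ (Finset.mem_univ a),
    ← Finset.mul_prod_erase _ _ hb]
  have hrest : (∏ v ∈ (Finset.univ.erase a).erase b,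
      (if v = a then Y a ∩ {q.1} else if v = b then Y b ∩ {q.2} else Y v).card) =
      ∏ v ∈ (Finset.univ.erase a).erase b, (Y v).card := by
    refine Finset.prod_congr rfl fun v hv => ?_
    simp only [Finset.mem_erase, Finset.mem_univ, and_true] at hv
    simp [hv.1, hv.2]
  rw [hrest]
  by_cases h1 : q.1 ∈ Y a <;> by_cases h2 : q.2 ∈ Y b <;>
    simp [h1, h2, hab.symm, Finset.mem_product, Finset.inter_singleton_of_mem,
      Finset.inter_singleton_of_notMem]

theorem sum_fiberCard {V α : Type*} [Fintype V] [DecidableEq V] [DecidableEq α] [Fintype α] (Y : V → Finset α) {a b : V}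
    (hab : a ≠ b) (F : Finset (α × α)) : ∑ q ∈ F, fiberCard Y a b q =
      (F ∩ Y a ×ˢ Y b).card * ∏ v ∈ (Finset.univ.erase a).erase b, ((Y v).card : ℝ) := by
  simp only [fiberCard_eq Y hab, Finset.sum_ite_mem, Finset.sum_const, nsmul_eq_mul]

theorem prod_card_eq {V α : Type*} [Fintype V] [DecidableEq V] [DecidableEq α] (Y : V → Finset α) {a b : V}
    (hab : a ≠ b) : ∏ v, ((Y v).card : ℝ) =
      (Y a).card * (Y b).card * ∏ v ∈ (Finset.univ.erase a).erase b, ((Y v).card : ℝ) := by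
  have hb : b ∈ Finset.univ.erase a := by simp [hab.symm]
  rw [← Finset.mul_prod_erase _ _ (Finset.mem_univ a), ← Finset.mul_prod_erase _ _ hb, mul_assoc]

theorem sum_univ_fiberCard {V α : Type*} [Fintype V] [DecidableEq V] [DecidableEq α] [Fintype α] (Y : V → Finset α) {a b : V}
    (hab : a ≠ b) : ∑ q, fiberCard Y a b q = ∏ v, ((Y v).card : ℝ) := by
  rw [sum_fiberCard Y hab, prod_card_eq Y hab]
  simp

/-- The three boxes into which `X × X'` cuts a box `Y` along the coordinates `a` and `b`. -/
theorem card_filter_box_split {V α : Type*} [Fintype V] [DecidableEq V] [DecidableEq α] (Y : V → Finset α) {a b : V} (hab : a ≠ b)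
    {X X' : Finset α} (hX : X ⊆ Y a) (hX' : X' ⊆ Y b) (P : (V → α) → Prop)
    [DecidablePred P] :
    ((Fintype.piFinset Y).filter P).card =
      ((Fintype.piFinset (Function.update (Function.update Y a X) b X')).filter P).card +
      ((Fintype.piFinset (Function.update (Function.update Y a X) b (Y b \ X'))).filter P).card +
      ((Fintype.piFinset (Function.update Y a (Y a \ X))).filter P).card := by
  have h1 : ∀ (Z Z' : Finset α) (φ : V → α),
      φ ∈ Fintype.piFinset (Function.update (Function.update Y a Z) b Z') ↔
      (∀ v, v ≠ a → v ≠ b → φ v ∈ Y v) ∧ φ a ∈ Z ∧ φ b ∈ Z' := by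
    intro Z Z' φ
    rw [Fintype.mem_piFinset]
    constructor
    · intro h
      refine ⟨fun v hva hvb => ?_, ?_, ?_⟩
      · simpa [hva, hvb] using h v
      · simpa [hab] using h a
      · simpa using h b
    · rintro ⟨h1, h2, h3⟩ v
      by_cases hvb : v = b
      · subst hvb; simpa using h3
      by_cases hva : v = a
      · subst hva; simpa [hab] using h2
      simpa [hva, hvb] using h1 v hva hvb
  have e1 : Y = Function.update (Function.update Y a (Y a)) b (Y b) := by simp
  have e2 : Function.update Y a (Y a \ X) =
      Function.update (Function.update Y a (Y a \ X)) b (Y b) := by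
    conv_rhs => rw [show Y b = Function.update Y a (Y a \ X) b by simp [hab.symm]]
    simp
  rw [e2]
  conv_lhs => rw [e1]
  rw [← Finset.card_union_of_disjoint, ← Finset.card_union_of_disjoint]
  · congr 1
    ext φ
    simp only [Finset.mem_union, Finset.mem_filter, h1, Finset.mem_sdiff]
    constructor
    · rintro ⟨⟨g1, g2, g3⟩, g4⟩
      by_cases g5 : φ a ∈ X <;> by_cases g6 : φ b ∈ X' <;> simp [g4, g5, g6, g2, g3] <;> exact g1
    · rintro ((⟨⟨g1, g2, g3⟩, g4⟩ | ⟨⟨g1, g2, g3⟩, g4⟩) | ⟨⟨g1, g2, g3⟩, g4⟩)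
      · exact ⟨⟨g1, hX g2, hX' g3⟩, g4⟩
      · exact ⟨⟨g1, hX g2, g3.1⟩, g4⟩
      · exact ⟨⟨g1, g2.1, g3⟩, g4⟩
  · rw [Finset.disjoint_left]
    intro φ
    simp only [Finset.mem_union, Finset.mem_filter, h1, Finset.mem_sdiff]
    tauto
  · rw [Finset.disjoint_left]
    intro φ
    simp only [Finset.mem_filter, h1, Finset.mem_sdiff]
    tauto

/-- `u a b` is a weight on pairs, a combination of indicators of large boxes that are sparse in
`R a b`, and the maps in `Y` through a pair bound its weight. -/
structure IsSparseWeight {V α : Type*} [Fintype V] [LinearOrder V] [Fintype α] [DecidableEq α]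
    (E : V → V → Prop) (R : V → V → Finset (α × α)) (δ ε : ℝ) (Y : V → Finset α)
    (u : V → V → α × α → ℝ) : Prop where
  nonneg : ∀ a b q, 0 ≤ u a b q
  support : ∀ a b, ¬(a < b ∧ E a b) → ∀ q, u a b q = 0
  sparse : ∀ a b, ∑ q ∈ R a b, u a b q ≤ δ * ∑ q, u a b q
  le_fiberCard : ∀ a b q, u a b q ≤ fiberCard Y a b q
  regular : ∀ a b (F : Finset (α × α)) (d : ℝ), (∀ X X' : Finset α,
    ε * Fintype.card α ≤ X.card → ε * Fintype.card α ≤ X'.card →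
      d * (X.card * X'.card) ≤ (F ∩ X ×ˢ X').card) → d * ∑ q, u a b q ≤ ∑ q ∈ F, u a b q

theorem fiberCard_nonneg {V α : Type*} [Fintype V] [DecidableEq V] [DecidableEq α] (Y : V → Finset α) (a b : V)
    (q : α × α) : 0 ≤ fiberCard Y a b q := Nat.cast_nonneg _

theorem IsSparseWeight.zero {V α : Type*} [Fintype V] [LinearOrder V] [Fintype α] [DecidableEq α]
    (E : V → V → Prop) (R : V → V → Finset (α × α)) (δ ε : ℝ) (Y : V → Finset α) :
    IsSparseWeight E R δ ε Y (fun _ _ _ => 0) where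
  nonneg _ _ _ := le_rfl
  support _ _ _ _ := rfl
  sparse _ _ := by simp
  le_fiberCard a b q := fiberCard_nonneg Y a b q
  regular _ _ _ _ _ := by simp

/-- `fiberCard` is constant on `Y a ×ˢ Y b` and zero elsewhere, so this weight is a multiple of the
indicator of one large sparse product. -/
theorem IsSparseWeight.box {V α : Type*} [Fintype V] [LinearOrder V] [Fintype α] [DecidableEq α]
    (E : V → V → Prop) (R : V → V → Finset (α × α)) (δ ε : ℝ) (Y : V → Finset α) {a b : V}
    (hab : a < b) (hE : E a b)
    (ha : ε * Fintype.card α ≤ (Y a).card) (hb : ε * Fintype.card α ≤ (Y b).card)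
    (hs : ((R a b ∩ Y a ×ˢ Y b).card : ℝ) ≤ δ * (Y a).card * (Y b).card) :
    IsSparseWeight E R δ ε Y
      (fun a' b' q => if a' = a ∧ b' = b then fiberCard Y a b q else 0) where
  nonneg a' b' q := by split_ifs; exacts [fiberCard_nonneg Y a b q, le_rfl]
  support a' b' h q := if_neg fun h' => h (by rw [h'.1, h'.2]; exact ⟨hab, hE⟩)
  sparse a' b' := by
    by_cases h : a' = a ∧ b' = b
    · obtain ⟨rfl, rfl⟩ := h
      simp only [and_self, if_true]
      rw [sum_univ_fiberCard Y hab.ne, sum_fiberCard Y hab.ne, prod_card_eq Y hab.ne, ← mul_assoc,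
        ← mul_assoc]
      exact mul_le_mul_of_nonneg_right hs (Finset.prod_nonneg fun _ _ => Nat.cast_nonneg _)
    · simp [h]
  le_fiberCard a' b' q := by
    split_ifs with h
    · rw [h.1, h.2]
    · exact fiberCard_nonneg Y a' b' q
  regular a' b' F d hd := by
    by_cases h : a' = a ∧ b' = b
    · obtain ⟨rfl, rfl⟩ := h
      simp only [and_self, if_true]
      rw [sum_univ_fiberCard Y hab.ne, sum_fiberCard Y hab.ne, prod_card_eq Y hab.ne, ← mul_assoc]
      exact mul_le_mul_of_nonneg_right (hd _ _ ha hb)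
        (Finset.prod_nonneg fun _ _ => Nat.cast_nonneg _)
    · simp [h]

/-- All conditions are linear, so weights on the pieces of a partitioned box add up. Bounding by
`fiberCard` lets contributions of different pairs `a`, `b` share the same volume. -/
theorem IsSparseWeight.mono {V α : Type*} [Fintype V] [LinearOrder V] [Fintype α] [DecidableEq α]
    {E : V → V → Prop} {R : V → V → Finset (α × α)} {δ ε : ℝ} {Y Y₁ Y₂ Y₃ : V → Finset α}
    {u₁ u₂ u₃ : V → V → α × α → ℝ}
    (hY : ∀ a b q, fiberCard Y a b q =
      fiberCard Y₁ a b q + fiberCard Y₂ a b q + fiberCard Y₃ a b q)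
    (h₁ : IsSparseWeight E R δ ε Y₁ u₁) (h₂ : IsSparseWeight E R δ ε Y₂ u₂)
    (h₃ : IsSparseWeight E R δ ε Y₃ u₃) :
    IsSparseWeight E R δ ε Y (fun a b q => u₁ a b q + u₂ a b q + u₃ a b q) where
  nonneg a b q := add_nonneg (add_nonneg (h₁.nonneg a b q) (h₂.nonneg a b q)) (h₃.nonneg a b q)
  support a b h q := by rw [h₁.support a b h, h₂.support a b h, h₃.support a b h]; norm_num
  sparse a b := by
    simp only [Finset.sum_add_distrib]
    have := h₁.sparse a b; have := h₂.sparse a b; have := h₃.sparse a b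
    linarith
  le_fiberCard a b q := by
    rw [hY]
    exact add_le_add (add_le_add (h₁.le_fiberCard a b q) (h₂.le_fiberCard a b q))
      (h₃.le_fiberCard a b q)
  regular a b F d hd := by
    simp only [Finset.sum_add_distrib]
    have := h₁.regular a b F d hd; have := h₂.regular a b F d hd; have := h₃.regular a b F d hd
    linarith

/-- If there are few copies, then any box can be exhausted by sparse sub-boxes. -/
theorem exists_sparse_weight {V α : Type*} [Fintype V] [LinearOrder V] [Fintype α] [DecidableEq α]
    (E : V → V → Prop) (R : V → V → Finset (α × α)) (δ s lam : ℝ) (hδ : 0 < δ) (hδ1 : δ ≤ 1)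
    (hs : 0 < s) (hα : 0 < Fintype.card α)
    (hlam : lam = δ ^ Fintype.card V / (2 * Fintype.card V)) (hlam0 : 0 ≤ lam) (hlam1 : lam ≤ 1)
    (hfew : ((partialCopies E R Finset.univ fun _ => (Finset.univ : Finset α)).card : ℝ) <
      (δ ^ Fintype.card V / 2) ^ Fintype.card V *
        (s * Fintype.card α) ^ Fintype.card V) (D : ℕ) :
    ∀ Y : V → Finset α, ∃ u, IsSparseWeight E R δ (lam * s) Y u ∧
      (1 - (1 - lam ^ 2) ^ D) * ∏ v, ((Y v).card : ℝ) -
        3 ^ D * (s * (Fintype.card α : ℝ) ^ Fintype.card V) ≤ ∑ a, ∑ b, ∑ q, u a b q := by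
  have hn : (0 : ℝ) < Fintype.card α := by exact_mod_cast hα
  have herr : 0 ≤ s * (Fintype.card α : ℝ) ^ Fintype.card V := by positivity
  have hρ0 : 0 ≤ 1 - lam ^ 2 := by nlinarith
  have hρ1 : 1 - lam ^ 2 ≤ 1 := by nlinarith
  -- `D` is the recursion depth. Each level takes out a proportion at least `lam ^ 2` of the box and
  -- leaves two smaller boxes. Boxes with a side below `s * Fintype.card α` are abandoned; `3 ^ D`
  -- generously bounds their number.
  induction D with
  | zero =>
    intro Y
    refine ⟨_, IsSparseWeight.zero E R δ _ Y, ?_⟩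
    simp only [pow_zero, sub_self, zero_mul, one_mul, Finset.sum_const_zero]
    linarith
  | succ D ih =>
    intro Y
    have hvol0 : 0 ≤ ∏ v, ((Y v).card : ℝ) := Finset.prod_nonneg fun _ _ => Nat.cast_nonneg _
    by_cases hsmall : ∃ v, ((Y v).card : ℝ) < s * Fintype.card α
    · obtain ⟨v, hv⟩ := hsmall
      refine ⟨_, IsSparseWeight.zero E R δ _ Y, ?_⟩
      simp only [Finset.sum_const_zero]
      have h1 : ∏ v, ((Y v).card : ℝ) ≤ s * (Fintype.card α : ℝ) ^ Fintype.card V := by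
        rw [← Finset.mul_prod_erase _ _ (Finset.mem_univ v)]
        have h2 : ∏ w ∈ Finset.univ.erase v, ((Y w).card : ℝ) ≤
            ∏ w ∈ Finset.univ.erase v, (Fintype.card α : ℝ) :=
          Finset.prod_le_prod (fun _ _ => Nat.cast_nonneg _)
            fun w _ => by exact_mod_cast Finset.card_le_univ _
        rw [Finset.prod_const, Finset.card_erase_of_mem (Finset.mem_univ v),
          Finset.card_univ] at h2
        have h3 : 0 < Fintype.card V := Fintype.card_pos_iff.2 ⟨v⟩
        calc ((Y v).card : ℝ) * ∏ w ∈ Finset.univ.erase v, ((Y w).card : ℝ)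
            ≤ (s * Fintype.card α) * (Fintype.card α : ℝ) ^ (Fintype.card V - 1) :=
              mul_le_mul hv.le h2 (Finset.prod_nonneg fun _ _ => Nat.cast_nonneg _) (by positivity)
          _ = s * (Fintype.card α : ℝ) ^ Fintype.card V := by
              rw [mul_assoc, ← pow_succ', Nat.sub_add_cancel h3]
      have h4 : 0 ≤ (1 - lam ^ 2) ^ (D + 1) := pow_nonneg hρ0 _
      have h5 : (1 : ℝ) ≤ 3 ^ (D + 1) := one_le_pow₀ (by norm_num)
      nlinarith
    · push Not at hsmall
      have hsparse : ∃ a b, a < b ∧ E a b ∧ ∃ X ⊆ Y a, ∃ X' ⊆ Y b,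
          lam * (Y a).card ≤ X.card ∧ lam * (Y b).card ≤ X'.card ∧
          ((R a b ∩ X ×ˢ X').card : ℝ) < δ * X.card * X'.card := by
        by_contra! hcon
        have hne : ∀ v, (Y v).Nonempty := fun v => by
          rw [← Finset.card_pos]
          have : (0 : ℝ) < (Y v).card := lt_of_lt_of_le (by positivity) (hsmall v)
          exact_mod_cast this
        have h1 := card_partialCopies_ge E R δ hδ hδ1 Y hne (by
          intro a b hab hE X hX X' hX' h2 h3
          rw [← hlam] at h2 h3
          exact hcon a b hab hE X hX X' hX' h2 h3) Finset.univ Y (fun _ _ => subset_rfl) (by simp)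
        have h2 : ((partialCopies E R Finset.univ Y).card : ℝ) ≤
            (partialCopies E R Finset.univ fun _ => (Finset.univ : Finset α)).card := by
          have : partialCopies E R Finset.univ Y ⊆
              partialCopies E R Finset.univ fun _ => (Finset.univ : Finset α) := by
            refine Finset.filter_subset_filter _ ?_
            exact Fintype.piFinset_subset _ _ fun v => Finset.subset_univ _
          exact_mod_cast Finset.card_le_card this
        have h3 : (s * (Fintype.card α : ℝ)) ^ Fintype.card V ≤ ∏ v, ((Y v).card : ℝ) := by
          rw [← Finset.card_univ (α := V), ← Finset.prod_const]
          exact Finset.prod_le_prod (fun _ _ => by positivity) fun v _ => hsmall v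
        rw [Finset.card_univ] at h1
        have h4 := mul_le_mul_of_nonneg_left h3
          (by positivity : 0 ≤ (δ ^ Fintype.card V / 2) ^ Fintype.card V)
        linarith
      obtain ⟨a, b, hab, hE, X, hX, X', hX', hXl, hXl', hlt⟩ := hsparse
      set K := Function.update (Function.update Y a X) b X' with hK
      set Y₁ := Function.update (Function.update Y a X) b (Y b \ X') with hY₁
      set Y₂ := Function.update Y a (Y a \ X) with hY₂
      have hKa : K a = X := by simp [hK, hab.ne]
      have hKb : K b = X' := by simp [hK]
      obtain ⟨u₁, hu₁, hw₁⟩ := ih Y₁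
      obtain ⟨u₂, hu₂, hw₂⟩ := ih Y₂
      have hbox : IsSparseWeight E R δ (lam * s) K
          (fun a' b' q => if a' = a ∧ b' = b then fiberCard K a b q else 0) := by
        refine IsSparseWeight.box E R δ _ K hab hE ?_ ?_ ?_
        · rw [hKa, mul_assoc]
          exact (mul_le_mul_of_nonneg_left (hsmall a) hlam0).trans hXl
        · rw [hKb, mul_assoc]
          exact (mul_le_mul_of_nonneg_left (hsmall b) hlam0).trans hXl'
        · rw [hKa, hKb]; exact hlt.le
      refine ⟨_, hbox.mono (fun a' b' q => ?_) hu₁ hu₂, ?_⟩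
      · simp only [fiberCard]
        exact_mod_cast card_filter_box_split Y hab.ne hX hX' fun φ => φ a' = q.1 ∧ φ b' = q.2
      · have hvol : ∏ v, ((Y v).card : ℝ) = ∏ v, ((K v).card : ℝ) + ∏ v, ((Y₁ v).card : ℝ) +
            ∏ v, ((Y₂ v).card : ℝ) := by
          have := card_filter_box_split Y hab.ne hX hX' fun _ => True
          simp only [Finset.filter_true, Fintype.card_piFinset] at this
          exact_mod_cast this
        have hKvol : lam ^ 2 * ∏ v, ((Y v).card : ℝ) ≤ ∏ v, ((K v).card : ℝ) := by
          rw [prod_card_eq Y hab.ne, prod_card_eq K hab.ne, hKa, hKb]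
          have h1 : ∏ v ∈ (Finset.univ.erase a).erase b, ((K v).card : ℝ) =
              ∏ v ∈ (Finset.univ.erase a).erase b, ((Y v).card : ℝ) := by
            refine Finset.prod_congr rfl fun v hv => ?_
            simp only [Finset.mem_erase, Finset.mem_univ, and_true] at hv
            simp [hK, hv.1, hv.2]
          rw [h1, ← mul_assoc]
          refine mul_le_mul_of_nonneg_right ?_ (Finset.prod_nonneg fun _ _ => Nat.cast_nonneg _)
          calc lam ^ 2 * ((Y a).card * (Y b).card) = (lam * (Y a).card) * (lam * (Y b).card) := by
                ring
            _ ≤ _ := mul_le_mul hXl hXl' (by positivity) (by positivity)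
        have hsum : ∑ a', ∑ b', ∑ q, (if a' = a ∧ b' = b then fiberCard K a b q else 0) =
            ∏ v, ((K v).card : ℝ) := by
          rw [Finset.sum_eq_single a, Finset.sum_eq_single b]
          · simp only [and_self, if_true]
            exact sum_univ_fiberCard K hab.ne
          · intro b' _ hb'; simp [hb']
          · simp
          · intro a' _ ha'; simp [ha']
          · simp
        simp only [Finset.sum_add_distrib, hsum]
        have h4 : 0 ≤ (1 - lam ^ 2) ^ D := pow_nonneg hρ0 _
        have h5 : (0 : ℝ) ≤ 3 ^ D * (s * (Fintype.card α : ℝ) ^ Fintype.card V) := by positivity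
        rw [pow_succ (1 - lam ^ 2) D, pow_succ (3 : ℝ) D]
        have h6 := mul_le_mul_of_nonneg_left hKvol h4
        have h8 : (1 - (1 - lam ^ 2) ^ D * (1 - lam ^ 2)) * ∏ v, ((Y v).card : ℝ) =
          (1 - (1 - lam ^ 2) ^ D) * ∏ v, ((Y v).card : ℝ) +
          (1 - lam ^ 2) ^ D * (lam ^ 2 * ∏ v, ((Y v).card : ℝ)) := by ring
        have h7 : (1 - (1 - lam ^ 2) ^ D) * ∏ v, ((Y v).card : ℝ) =
          (1 - (1 - lam ^ 2) ^ D) * ∏ v, ((K v).card : ℝ) +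
          (1 - (1 - lam ^ 2) ^ D) * ∏ v, ((Y₁ v).card : ℝ) +
          (1 - (1 - lam ^ 2) ^ D) * ∏ v, ((Y₂ v).card : ℝ) := by rw [hvol]; ring
        linarith

/-- If `R` contains few copies, then for some pair `a < b` there is a sparse set `B ⊆ R a b` which
every regular `F ⊆ R a b` meets in a positive proportion. -/
theorem exists_sparse_intersecting {V : Type*} [Fintype V] [LinearOrder V] (E : V → V → Prop)
    (k : ℕ) (hk : (Finset.univ.filter fun p : V × V => p.1 < p.2 ∧ E p.1 p.2).card = k)
    (hk0 : 0 < k) (δ : ℝ) (hδ : 0 < δ) (hδ1 : δ ≤ 1) :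
    ∃ ε : ℝ, 0 < ε ∧ ∃ c : ℝ, 0 < c ∧ ∀ {α : Type*} [Fintype α] [DecidableEq α]
       (R : V → V → Finset (α × α)),
      0 < Fintype.card α →
      ((partialCopies E R Finset.univ fun _ => (Finset.univ : Finset α)).card : ℝ) <
        c * (Fintype.card α : ℝ) ^ Fintype.card V →
      ∃ a b, a < b ∧ E a b ∧ ∃ B ⊆ R a b, (B.card : ℝ) ≤ δ * (Fintype.card α : ℝ) ^ 2 ∧
        ∀ F ⊆ R a b, (∀ X X' : Finset α,
          ε * Fintype.card α ≤ X.card → ε * Fintype.card α ≤ X'.card →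
            3 / 4 * (F.card / (Fintype.card α : ℝ) ^ 2) * (X.card * X'.card) ≤
              (F ∩ X ×ˢ X').card) → (F.card : ℝ) / (8 * k) ≤ (F ∩ B).card := by
  have hkR : (0 : ℝ) < k := by exact_mod_cast hk0
  have hk1 : (1 : ℝ) ≤ k := by exact_mod_cast hk0
  have hV : 0 < Fintype.card V := by
    have : 0 < (Finset.univ.filter fun p : V × V => p.1 < p.2 ∧ E p.1 p.2).card := hk ▸ hk0
    obtain ⟨p, _⟩ := Finset.card_pos.1 this
    exact Fintype.card_pos_iff.2 ⟨p.1⟩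
  have hV1 : (1 : ℝ) ≤ Fintype.card V := by exact_mod_cast hV
  -- `B` will consist of the pairs of weight at least `P / (4 * k)`; Markov's inequality then loses
  -- the factor `4 * k`.
  obtain ⟨δ', hδ'⟩ : ∃ δ', δ' = δ / (4 * k) := ⟨_, rfl⟩
  have hδ'0 : 0 < δ' := by rw [hδ']; positivity
  have hδ'1 : δ' ≤ 1 := by
    rw [hδ', div_le_one (by positivity)]
    linarith
  obtain ⟨lam, hlam⟩ : ∃ lam, lam = δ' ^ Fintype.card V / (2 * Fintype.card V) := ⟨_, rfl⟩
  have hlam0 : 0 < lam := by rw [hlam]; positivity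
  have hlam1 : lam ≤ 1 := by
    rw [hlam, div_le_one (by positivity)]
    have := pow_le_one₀ (n := Fintype.card V) hδ'0.le hδ'1
    linarith
  -- `D` and `s` make the uncovered and the abandoned volume at most a quarter each.
  obtain ⟨D, hD⟩ := exists_pow_lt_of_lt_one (by norm_num : (0 : ℝ) < 1 / 4)
    (by nlinarith : 1 - lam ^ 2 < 1)
  have h3 : (0 : ℝ) < 3 ^ D := by positivity
  obtain ⟨s, hs⟩ : ∃ s : ℝ, s = 1 / (4 * 3 ^ D) := ⟨_, rfl⟩
  have hs0 : 0 < s := by rw [hs]; positivity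
  refine ⟨lam * s, by positivity,
    (δ' ^ Fintype.card V / 2) ^ Fintype.card V * s ^ Fintype.card V, by positivity, ?_⟩
  intro α _ _ R hα hfew
  have hn : (0 : ℝ) < Fintype.card α := by exact_mod_cast hα
  obtain ⟨u, hu, hsum⟩ := exists_sparse_weight E R δ' s lam hδ'0 hδ'1 hs0 hα hlam hlam0.le hlam1
    (by rw [mul_pow, ← mul_assoc]; exact hfew) D fun _ => Finset.univ
  set n : ℝ := (Fintype.card α : ℝ) with hndef
  have hvol : ∏ _v : V, ((Finset.univ : Finset α).card : ℝ) = n ^ Fintype.card V := by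
    rw [Finset.prod_const, Finset.card_univ, Finset.card_univ]
  have hnV : 0 < n ^ Fintype.card V := by positivity
  have htot : n ^ Fintype.card V / 2 ≤ ∑ a, ∑ b, ∑ q, u a b q := by
    rw [hvol] at hsum
    have h4 : 3 ^ D * (s * n ^ Fintype.card V) = n ^ Fintype.card V / 4 := by
      rw [hs]; field_simp
    rw [h4] at hsum
    have h5 := mul_lt_mul_of_pos_right hD hnV
    linarith
  have htot2 : ∑ a, ∑ b, ∑ q, u a b q =
      ∑ p ∈ Finset.univ.filter fun p : V × V => p.1 < p.2 ∧ E p.1 p.2, ∑ q, u p.1 p.2 q := by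
    rw [← Fintype.sum_prod_type', Finset.sum_filter_of_ne]
    intro p _ hp
    by_contra hcon
    exact hp (Finset.sum_eq_zero fun q _ => hu.support _ _ hcon q)
  have hpair : ∃ p ∈ Finset.univ.filter fun p : V × V => p.1 < p.2 ∧ E p.1 p.2,
      n ^ Fintype.card V / (2 * k) ≤ ∑ q, u p.1 p.2 q := by
    refine Finset.exists_le_of_sum_le (Finset.card_pos.1 (hk ▸ hk0)) ?_
    rw [Finset.sum_const, hk, nsmul_eq_mul, ← htot2]
    refine le_trans (le_of_eq ?_) htot
    field_simp
  obtain ⟨⟨a, b⟩, hab, hp⟩ := hpair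
  simp only [Finset.mem_filter, Finset.mem_univ, true_and] at hab hp
  obtain ⟨hab, hE⟩ := hab
  obtain ⟨P, hPdef⟩ : ∃ P, P = ∏ v ∈ (Finset.univ.erase a).erase b,
    (((fun _ => Finset.univ : V → Finset α) v).card : ℝ) := ⟨_, rfl⟩
  have hP : 0 < P := by
    rw [hPdef]
    exact Finset.prod_pos fun _ _ => by simpa using hα
  have hnP : n ^ Fintype.card V = n ^ 2 * P := by
    rw [← hvol, prod_card_eq (fun _ => (Finset.univ : Finset α)) hab.ne, ← hPdef, Finset.card_univ,
      ← hndef, sq]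
  have huP : ∀ q, u a b q ≤ P := by
    intro q
    refine (hu.le_fiberCard a b q).trans ?_
    rw [fiberCard_eq _ hab.ne, ← hPdef]
    simp
  have htotle : ∑ q, u a b q ≤ n ^ 2 * P := by
    refine (Finset.sum_le_sum fun q _ => hu.le_fiberCard a b q).trans ?_
    rw [sum_univ_fiberCard _ hab.ne, hvol, hnP]
  have hP4 : 0 < P / (4 * k) := by positivity
  -- A regular `F` has weight at least `3 |F| P / (8 k)`. Its pairs below the threshold carry at
  -- most `|F| P / (4 k)`, and a pair in `B` weighs at most `P`, so `|F| / (8 k)` pairs lie in `B`.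
  refine ⟨a, b, hab, hE, (R a b).filter fun q => P / (4 * k) ≤ u a b q, Finset.filter_subset _ _,
    ?_, ?_⟩
  · have h1 : (((R a b).filter fun q => P / (4 * k) ≤ u a b q).card : ℝ) * (P / (4 * k)) ≤
        δ' * (n ^ 2 * P) := by
      rw [← nsmul_eq_mul, ← Finset.sum_const]
      calc ∑ q ∈ (R a b).filter fun q => P / (4 * k) ≤ u a b q, P / (4 * k)
          ≤ ∑ q ∈ (R a b).filter fun q => P / (4 * k) ≤ u a b q, u a b q :=
            Finset.sum_le_sum fun q hq => (Finset.mem_filter.1 hq).2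
        _ ≤ ∑ q ∈ R a b, u a b q := Finset.sum_le_sum_of_subset_of_nonneg
            (Finset.filter_subset _ _) fun q _ _ => hu.nonneg a b q
        _ ≤ δ' * ∑ q, u a b q := hu.sparse a b
        _ ≤ _ := mul_le_mul_of_nonneg_left htotle hδ'0.le
    have h2 : δ' * (n ^ 2 * P) = (δ * n ^ 2) * (P / (4 * k)) := by rw [hδ']; field_simp
    rw [h2] at h1
    exact le_of_mul_le_mul_right h1 hP4
  · intro F hF hreg
    have h1 := hu.regular a b F _ fun X X' => hreg X X'
    have h2 : ∑ q ∈ F, u a b q ≤ (F ∩ (R a b).filter fun q => P / (4 * k) ≤ u a b q).card * P +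
        F.card * (P / (4 * k)) := by
      have : ∀ q ∈ F, u a b q ≤ (if q ∈ (R a b).filter fun q => P / (4 * k) ≤ u a b q then P
          else 0) + P / (4 * k) := by
        intro q hq
        by_cases hq' : P / (4 * k) ≤ u a b q
        · have hm : q ∈ (R a b).filter fun q => P / (4 * k) ≤ u a b q :=
            Finset.mem_filter.2 ⟨hF hq, hq'⟩
          rw [if_pos hm]
          linarith [huP q]
        · have hm : q ∉ (R a b).filter fun q => P / (4 * k) ≤ u a b q :=
            fun h => hq' (Finset.mem_filter.1 h).2
          rw [if_neg hm]
          linarith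
      refine (Finset.sum_le_sum this).trans ?_
      rw [Finset.sum_add_distrib, Finset.sum_ite_mem, Finset.sum_const, Finset.sum_const,
        nsmul_eq_mul, nsmul_eq_mul]
    have h3 : 3 / 4 * (F.card / n ^ 2) * (n ^ 2 * P / (2 * k)) ≤
        3 / 4 * (F.card / n ^ 2) * ∑ q, u a b q := by
      rw [← hnP]
      exact mul_le_mul_of_nonneg_left hp (by positivity)
    have h4 : 3 / 4 * (F.card / n ^ 2) * (n ^ 2 * P / (2 * k)) =
        (F.card / (8 * k) * P) + (F.card * (P / (4 * k))) := by
      field_simp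
      ring
    have h5 : (F.card : ℝ) / (8 * k) * P ≤
        (F ∩ (R a b).filter fun q => P / (4 * k) ≤ u a b q).card * P := by linarith
    exact le_of_mul_le_mul_right h5 hP

/-! ### Counting tuples of `m`-sets by fingerprints -/

theorem choose_le_pow_mul_choose {x N : ℕ} {δ : ℝ} (hδ : 0 ≤ δ) (hδ1 : δ ≤ 1)
    (h : (x : ℝ) ≤ δ * N) (a : ℕ) : (x.choose a : ℝ) ≤ δ ^ a * N.choose a := by
  induction a generalizing x N with
  | zero => simp
  | succ a ih =>
    rcases x with _ | x
    · simp only [Nat.choose_zero_succ, Nat.cast_zero]; positivity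
    rcases N with _ | N
    · push_cast at h
      have : (0 : ℝ) ≤ x := Nat.cast_nonneg x
      linarith
    have h1 : (x : ℝ) ≤ δ * N := by push_cast at h; linarith
    have e1 : ((x + 1 : ℕ) : ℝ) * x.choose a = (x + 1).choose (a + 1) * (a + 1 : ℕ) := by
      exact_mod_cast Nat.add_one_mul_choose_eq x a
    have e2 : ((N + 1 : ℕ) : ℝ) * N.choose a = (N + 1).choose (a + 1) * (a + 1 : ℕ) := by
      exact_mod_cast Nat.add_one_mul_choose_eq N a
    have ha : (0 : ℝ) < (a + 1 : ℕ) := by positivity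
    refine le_of_mul_le_mul_right ?_ ha
    calc ((x + 1).choose (a + 1) : ℝ) * (a + 1 : ℕ) = ((x + 1 : ℕ) : ℝ) * x.choose a := e1.symm
      _ ≤ (δ * (N + 1 : ℕ)) * (δ ^ a * N.choose a) :=
          mul_le_mul h (ih h1) (by positivity) (by positivity)
      _ = δ ^ (a + 1) * (((N + 1 : ℕ) : ℝ) * N.choose a) := by ring
      _ = δ ^ (a + 1) * (N + 1).choose (a + 1) * (a + 1 : ℕ) := by rw [e2]; ring

theorem card_superset_filter {α : Type*} [Fintype α] [DecidableEq α] (T : Finset α) (m : ℕ) (hT : T.card ≤ m) :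
    ((Finset.powersetCard m (Finset.univ : Finset α)).filter fun F => T ⊆ F).card =
      (Fintype.card α - T.card).choose (m - T.card) := by
  have : (Finset.powersetCard (m - T.card) Tᶜ).card =
      (Fintype.card α - T.card).choose (m - T.card) := by
    rw [Finset.card_powersetCard, Finset.card_compl]
  rw [← this]
  refine Finset.card_bij' (fun F _ => F \ T) (fun F _ => F ∪ T) ?_ ?_ ?_ ?_
  · intro F hF
    simp only [Finset.mem_filter, Finset.mem_powersetCard, Finset.subset_univ, true_and] at hF
    rw [Finset.mem_powersetCard]
    refine ⟨fun x hx => by simpa using (Finset.mem_sdiff.1 hx).2, ?_⟩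
    rw [Finset.card_sdiff_of_subset hF.2, hF.1]
  · intro F hF
    rw [Finset.mem_powersetCard] at hF
    have hd : Disjoint F T := Finset.disjoint_left.2 fun x hx => by simpa using hF.1 hx
    simp only [Finset.mem_filter, Finset.mem_powersetCard, Finset.subset_univ, true_and]
    refine ⟨?_, Finset.subset_union_right⟩
    rw [Finset.card_union_of_disjoint hd, hF.2]; omega
  · intro F hF
    simp only [Finset.mem_filter] at hF
    exact Finset.sdiff_union_of_subset hF.2
  · intro F hF
    rw [Finset.mem_powersetCard] at hF
    have hd : Disjoint F T := Finset.disjoint_left.2 fun x hx => by simpa using hF.1 hx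
    exact Finset.union_sdiff_cancel_right hd

/-- Among the `m`-sets containing `T`, few meet a sparse set `B` often. -/
theorem card_superset_meeting_le {α : Type*} [Fintype α] [DecidableEq α] (T B : Finset α) (m a : ℕ) (δ : ℝ)
    (hδ : 0 ≤ δ) (hδ1 : δ ≤ 1) (hB : (B.card : ℝ) ≤ δ * (Fintype.card α - T.card : ℕ)) :
    (((Finset.powersetCard m (Finset.univ : Finset α)).filter fun F =>
      T ⊆ F ∧ a ≤ ((F ∩ B) \ T).card).card : ℝ) ≤ δ ^ a * 2 ^ m *
      ((Finset.powersetCard m (Finset.univ : Finset α)).filter fun F => T ⊆ F).card := by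
  by_cases hTm : T.card + a ≤ m
  swap
  · have : ((Finset.powersetCard m (Finset.univ : Finset α)).filter fun F =>
        T ⊆ F ∧ a ≤ ((F ∩ B) \ T).card) = ∅ := by
      refine Finset.filter_eq_empty_iff.2 fun F hF h => hTm ?_
      rw [Finset.mem_powersetCard] at hF
      have h1 : ((F ∩ B) \ T).card ≤ (F \ T).card :=
        Finset.card_le_card (Finset.sdiff_subset_sdiff Finset.inter_subset_left subset_rfl)
      rw [Finset.card_sdiff_of_subset h.1, hF.2] at h1
      have h2 := Finset.card_le_card h.1
      omega
    rw [this]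
    simp only [Finset.card_empty, Nat.cast_zero]
    positivity
  have hsub : ((Finset.powersetCard m (Finset.univ : Finset α)).filter fun F =>
      T ⊆ F ∧ a ≤ ((F ∩ B) \ T).card) ⊆ (Finset.powersetCard a (B \ T)).biUnion fun J =>
        (Finset.powersetCard m (Finset.univ : Finset α)).filter fun F => T ∪ J ⊆ F := by
    intro F hF
    obtain ⟨h1, h2, h3⟩ := Finset.mem_filter.1 hF
    obtain ⟨J, hJ, hJa⟩ := Finset.exists_subset_card_eq h3
    refine Finset.mem_biUnion.2 ⟨J, Finset.mem_powersetCard.2 ⟨fun x hx => ?_, hJa⟩,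
      Finset.mem_filter.2 ⟨h1, Finset.union_subset h2 fun x hx => ?_⟩⟩
    · have := hJ hx
      simp only [Finset.mem_sdiff, Finset.mem_inter] at this ⊢
      exact ⟨this.1.2, this.2⟩
    · exact (Finset.mem_inter.1 (Finset.mem_sdiff.1 (hJ hx)).1).1
  have hcount : ∀ J ∈ Finset.powersetCard a (B \ T),
      ((Finset.powersetCard m (Finset.univ : Finset α)).filter fun F => T ∪ J ⊆ F).card =
      (Fintype.card α - T.card - a).choose (m - T.card - a) := by
    intro J hJ
    rw [Finset.mem_powersetCard] at hJ
    have hd : Disjoint T J := Finset.disjoint_right.2 fun x hx => (Finset.mem_sdiff.1 (hJ.1 hx)).2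
    have hc : (T ∪ J).card = T.card + a := by rw [Finset.card_union_of_disjoint hd, hJ.2]
    rw [card_superset_filter _ _ (by omega), hc, Nat.sub_sub, Nat.sub_sub]
  have h1 := (Finset.card_le_card hsub).trans Finset.card_biUnion_le
  rw [Finset.sum_congr rfl hcount, Finset.sum_const, Finset.card_powersetCard, smul_eq_mul] at h1
  rw [card_superset_filter T m (by omega)]
  have h2 : ((B \ T).card : ℝ) ≤ δ * (Fintype.card α - T.card : ℕ) :=
    le_trans (by exact_mod_cast Finset.card_le_card Finset.sdiff_subset) hB
  have h3 := choose_le_pow_mul_choose hδ hδ1 h2 a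
  set N := Fintype.card α - T.card
  -- Choosing `J` and then the rest of `F \ T` equals choosing `F \ T` and then `J` inside it; out
  -- of range, both sides vanish.
  have h4 : N.choose a * (N - a).choose (m - T.card - a) =
      N.choose (m - T.card) * (m - T.card).choose a := by
    by_cases hN : m - T.card ≤ N
    · exact (Nat.choose_mul (n := N) (k := m - T.card) (s := a) (by omega)).symm
    · have hN1 : N.choose (m - T.card) = 0 := Nat.choose_eq_zero_of_lt (by omega)
      by_cases hNa : a ≤ N
      · rw [Nat.choose_eq_zero_of_lt (by omega : N - a < m - T.card - a), hN1]; simp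
      · rw [Nat.choose_eq_zero_of_lt (by omega : N < a), hN1]; simp
  have h5 : (m - T.card).choose a ≤ 2 ^ m :=
    (Nat.choose_le_two_pow _ _).trans (Nat.pow_le_pow_right (by norm_num) (Nat.sub_le _ _))
  calc (((Finset.powersetCard m (Finset.univ : Finset α)).filter fun F =>
      T ⊆ F ∧ a ≤ ((F ∩ B) \ T).card).card : ℝ)
      ≤ ((B \ T).card.choose a : ℝ) * (N - a).choose (m - T.card - a) := by exact_mod_cast h1
    _ ≤ (δ ^ a * N.choose a) * (N - a).choose (m - T.card - a) := by gcongr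
    _ = δ ^ a * ((N.choose a * (N - a).choose (m - T.card - a) : ℕ) : ℝ) := by push_cast; ring
    _ = δ ^ a * (m - T.card).choose a * N.choose (m - T.card) := by rw [h4]; push_cast; ring
    _ ≤ δ ^ a * 2 ^ m * N.choose (m - T.card) := by
        gcongr
        exact_mod_cast h5

/-- Each tuple of `m`-sets has at most `2 ^ m` subsets in each coordinate. -/
theorem sum_card_supersets_le {ι α : Type*} [Fintype ι] [Fintype α] [DecidableEq α] (m : ℕ)
    (all : Finset (ι → Finset α)) (hall : ∀ F ∈ all, ∀ i, (F i).card = m)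
    (𝒮 : Finset (ι → Finset α)) : ∑ S ∈ 𝒮, (all.filter fun F => ∀ i, S i ⊆ F i).card ≤
      all.card * (2 ^ m) ^ Fintype.card ι := by
  calc ∑ S ∈ 𝒮, (all.filter fun F => ∀ i, S i ⊆ F i).card
      = ∑ F ∈ all, (𝒮.filter fun S => ∀ i, S i ⊆ F i).card := by
        simp only [Finset.card_filter]
        exact Finset.sum_comm
    _ ≤ ∑ F ∈ all, (2 ^ m) ^ Fintype.card ι := by
        refine Finset.sum_le_sum fun F hF => ?_
        have : (𝒮.filter fun S => ∀ i, S i ⊆ F i) ⊆ Fintype.piFinset fun i => (F i).powerset := by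
          intro S hS
          rw [Fintype.mem_piFinset]
          exact fun i => Finset.mem_powerset.2 ((Finset.mem_filter.1 hS).2 i)
        refine (Finset.card_le_card this).trans (le_of_eq ?_)
        rw [Fintype.card_piFinset]
        simp [Finset.card_powerset, hall F hF]
    _ = _ := by rw [Finset.sum_const, smul_eq_mul]

/-- A family of tuples of `m`-sets is small, if each of its members contains a fingerprint that
determines a coordinate and a sparse set which the member meets often in that coordinate. -/
theorem card_le_of_fingerprint {ι α : Type*} [Fintype ι] [Fintype α] [DecidableEq α] (m a t : ℕ) (δ : ℝ)
    (hδ : 0 ≤ δ) (hδ1 : δ ≤ 1) (𝓕 : Finset (ι → Finset α)) (h𝓕 : ∀ F ∈ 𝓕, ∀ i, (F i).card = m)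
    (T : (ι → Finset α) → ι → Finset α) (i₀ : (ι → Finset α) → ι)
    (B : (ι → Finset α) → Finset α)
    (hT : ∀ F ∈ 𝓕, ∀ i, T F i ⊆ F i) (ht : ∀ F ∈ 𝓕, (T F (i₀ F)).card ≤ t)
    (hdet : ∀ F ∈ 𝓕, ∀ F' ∈ 𝓕, T F = T F' → i₀ F = i₀ F' ∧ B F = B F')
    (hB : ∀ F ∈ 𝓕, ((B F).card : ℝ) ≤ δ * (Fintype.card α - t : ℕ))
    (hmeet : ∀ F ∈ 𝓕, a + t ≤ (F (i₀ F) ∩ B F).card) :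
    (𝓕.card : ℝ) ≤ δ ^ a * 2 ^ m * (2 ^ m) ^ Fintype.card ι *
      ((Fintype.card α).choose m : ℝ) ^ Fintype.card ι := by
  set all : Finset (ι → Finset α) :=
    Fintype.piFinset fun _ => Finset.powersetCard m (Finset.univ : Finset α) with hall
  -- Comparing each fibre with all tuples above its fingerprint leaves a sum that double counting
  -- bounds, with no separate count of fingerprints.
  have hfib : ∀ S ∈ 𝓕.image T, ((𝓕.filter fun F => T F = S).card : ℝ) ≤
      δ ^ a * 2 ^ m * (all.filter fun F => ∀ i, S i ⊆ F i).card := by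
    intro S hS
    obtain ⟨F₀, hF₀, rfl⟩ := Finset.mem_image.1 hS
    set j := i₀ F₀
    let P : ι → Finset (Finset α) := fun i =>
      (Finset.powersetCard m (Finset.univ : Finset α)).filter fun F => T F₀ i ⊆ F
    let P' : Finset (Finset α) := (Finset.powersetCard m (Finset.univ : Finset α)).filter fun F =>
      T F₀ j ⊆ F ∧ a ≤ ((F ∩ B F₀) \ T F₀ j).card
    have hall' : (all.filter fun F => ∀ i, T F₀ i ⊆ F i) = Fintype.piFinset P := by
      ext F
      simp only [hall, P, Finset.mem_filter, Fintype.mem_piFinset]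
      exact ⟨fun h i => ⟨h.1 i, h.2 i⟩, fun h => ⟨fun i => (h i).1, fun i => (h i).2⟩⟩
    have hsub : (𝓕.filter fun F => T F = T F₀) ⊆ Fintype.piFinset (Function.update P j P') := by
      intro F hF
      obtain ⟨hF, hTF⟩ := Finset.mem_filter.1 hF
      obtain ⟨e1, e2⟩ := hdet F hF F₀ hF₀ hTF
      have h1 : ∀ i, F i ∈ P i := fun i => Finset.mem_filter.2
        ⟨Finset.mem_powersetCard.2 ⟨Finset.subset_univ _, h𝓕 F hF i⟩, hTF ▸ hT F hF i⟩
      rw [Fintype.mem_piFinset]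
      intro i
      by_cases hi : i = j
      · subst hi
        rw [Function.update_self]
        refine Finset.mem_filter.2 ⟨(Finset.mem_filter.1 (h1 j)).1, (Finset.mem_filter.1 (h1 j)).2, ?_⟩
        have h2 := hmeet F hF
        have h3 := ht F₀ hF₀
        rw [e1, e2] at h2
        have h4 := Finset.le_card_sdiff (T F₀ j) (F j ∩ B F₀)
        change a + t ≤ (F j ∩ B F₀).card at h2
        change (T F₀ j).card ≤ t at h3
        omega
      · rw [Function.update_of_ne hi]
        exact h1 i
    have h5 : (P'.card : ℝ) ≤ δ ^ a * 2 ^ m * (P j).card := by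
      refine card_superset_meeting_le (T F₀ j) (B F₀) m a δ hδ hδ1 ((hB F₀ hF₀).trans ?_)
      refine mul_le_mul_of_nonneg_left ?_ hδ
      exact_mod_cast Nat.sub_le_sub_left (ht F₀ hF₀) _
    have h6 := Finset.card_le_card hsub
    rw [hall', Fintype.card_piFinset]
    rw [Fintype.card_piFinset, ← Finset.mul_prod_erase _ _ (Finset.mem_univ j),
      Function.update_self, Finset.prod_congr rfl fun i hi => by
        rw [Function.update_of_ne (Finset.ne_of_mem_erase hi)]] at h6
    rw [← Finset.mul_prod_erase _ _ (Finset.mem_univ j)]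
    calc ((𝓕.filter fun F => T F = T F₀).card : ℝ)
        ≤ (P'.card : ℝ) * ((∏ i ∈ Finset.univ.erase j, (P i).card : ℕ) : ℝ) := by
          exact_mod_cast h6
      _ ≤ (δ ^ a * 2 ^ m * (P j).card) * ((∏ i ∈ Finset.univ.erase j, (P i).card : ℕ) : ℝ) :=
          mul_le_mul_of_nonneg_right h5 (Nat.cast_nonneg _)
      _ = _ := by rw [Nat.cast_mul, mul_assoc]
  have hcard : 𝓕.card = ∑ S ∈ 𝓕.image T, (𝓕.filter fun F => T F = S).card :=
    Finset.card_eq_sum_card_image T 𝓕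
  have hall_card : all.card = (Fintype.card α).choose m ^ Fintype.card ι := by
    rw [hall, Fintype.card_piFinset]; simp
  have hdouble := sum_card_supersets_le m all (fun F hF i => by
    have := Fintype.mem_piFinset.1 hF i
    exact (Finset.mem_powersetCard.1 this).2) (𝓕.image T)
  calc (𝓕.card : ℝ) = ∑ S ∈ 𝓕.image T, ((𝓕.filter fun F => T F = S).card : ℝ) := by
        exact_mod_cast hcard
    _ ≤ ∑ S ∈ 𝓕.image T, δ ^ a * 2 ^ m * (all.filter fun F => ∀ i, S i ⊆ F i).card :=
        Finset.sum_le_sum hfib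
    _ = δ ^ a * 2 ^ m *
        ((∑ S ∈ 𝓕.image T, (all.filter fun F => ∀ i, S i ⊆ F i).card : ℕ) : ℝ) := by
        rw [← Finset.mul_sum]; push_cast; rfl
    _ ≤ δ ^ a * 2 ^ m * ((all.card * (2 ^ m) ^ Fintype.card ι : ℕ) : ℝ) := by
        refine mul_le_mul_of_nonneg_left ?_ (by positivity)
        exact_mod_cast hdouble
    _ = _ := by rw [hall_card]; push_cast; ring

/-! ### Ordered edges and the 2-density -/

/-- The edges of a graph on a linearly ordered vertex set, as increasing pairs. -/
abbrev OrdEdge {V : Type u} [LinearOrder V] (H : SimpleGraph V) : Type u :=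
  {p : V × V // p.1 < p.2 ∧ H.Adj p.1 p.2}

section OrdEdge

variable {V : Type u} [LinearOrder V] {H : SimpleGraph V}

theorem ordEdge_sym2_injective :
    Function.Injective fun p : OrdEdge H => s(p.1.1, p.1.2) := by
  rintro ⟨⟨a, b⟩, hab, _⟩ ⟨⟨a', b'⟩, hab', _⟩ h
  simp only [Sym2.eq_iff] at h
  rcases h with ⟨rfl, rfl⟩ | ⟨rfl, rfl⟩
  · rfl
  · exact absurd hab hab'.not_gt

theorem card_ordEdge [Fintype V] : Fintype.card (OrdEdge H) = H.edgeSet.ncard := by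
  have : H.edgeSet = (fun p : OrdEdge H => s(p.1.1, p.1.2)) '' Set.univ := by
    ext e
    induction e with
    | _ x y =>
      simp only [SimpleGraph.mem_edgeSet, Set.image_univ, Set.mem_range]
      constructor
      · intro h
        rcases lt_or_gt_of_ne h.ne with hlt | hlt
        · exact ⟨⟨(x, y), hlt, h⟩, rfl⟩
        · exact ⟨⟨(y, x), hlt, h.symm⟩, Sym2.eq_swap⟩
      · rintro ⟨⟨⟨a, b⟩, hab, h⟩, he⟩
        rcases Sym2.eq_iff.1 he with ⟨rfl, rfl⟩ | ⟨rfl, rfl⟩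
        exacts [h, h.symm]
  rw [this, Set.ncard_image_of_injective _ ordEdge_sym2_injective, Set.ncard_univ,
    Nat.card_eq_fintype_card]

/-- The vertices covered by a set of edges. -/
noncomputable def ordEdgeVerts (J : Finset (OrdEdge H)) : Finset V :=
  J.biUnion fun p => {p.1.1, p.1.2}

theorem pair_subset_ordEdgeVerts {J : Finset (OrdEdge H)} {p : OrdEdge H} (hp : p ∈ J) :
    {p.1.1, p.1.2} ⊆ ordEdgeVerts J :=
  Finset.subset_biUnion_of_mem (fun p : OrdEdge H => ({p.1.1, p.1.2} : Finset V)) hp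

theorem two_le_card_ordEdgeVerts {J : Finset (OrdEdge H)} (hJ : J.Nonempty) :
    2 ≤ (ordEdgeVerts J).card := by
  obtain ⟨p, hp⟩ := hJ
  rw [← Finset.card_pair p.2.1.ne]
  exact Finset.card_le_card (pair_subset_ordEdgeVerts hp)

theorem three_le_card_ordEdgeVerts {J : Finset (OrdEdge H)} (hJ : 2 ≤ J.card) :
    3 ≤ (ordEdgeVerts J).card := by
  obtain ⟨p, hp, q, hq, hpq⟩ := Finset.one_lt_card.1 hJ
  by_contra! hlt
  have h1 : {p.1.1, p.1.2} = ordEdgeVerts J := Finset.eq_of_subset_of_card_le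
    (pair_subset_ordEdgeVerts hp) (by rw [Finset.card_pair p.2.1.ne]; omega)
  have h2 := pair_subset_ordEdgeVerts hq
  rw [← h1] at h2
  have h3 : q.1.1 ∈ ({p.1.1, p.1.2} : Finset V) := h2 (by simp)
  have h4 : q.1.2 ∈ ({p.1.1, p.1.2} : Finset V) := h2 (by simp)
  simp only [Finset.mem_insert, Finset.mem_singleton] at h3 h4
  have hp' := p.2.1
  have hq' := q.2.1
  rcases h3 with h3 | h3 <;> rcases h4 with h4 | h4
  · rw [h3, h4] at hq'; exact lt_irrefl _ hq'
  · exact hpq (Subtype.ext (Prod.ext h3.symm h4.symm))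
  · rw [h3, h4] at hq'; exact lt_asymm hp' hq'
  · rw [h3, h4] at hq'; exact lt_irrefl _ hq'

/-- The subgraph formed by a set of edges. -/
def ordEdgeSubgraph (J : Finset (OrdEdge H)) : H.Subgraph where
  verts := ordEdgeVerts J
  Adj x y := ∃ p ∈ J, s(p.1.1, p.1.2) = s(x, y)
  adj_sub := by
    rintro x y ⟨p, _, h⟩
    rcases Sym2.eq_iff.1 h with ⟨rfl, rfl⟩ | ⟨rfl, rfl⟩
    exacts [p.2.2, p.2.2.symm]
  edge_vert := by
    rintro x y ⟨p, hp, h⟩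
    have h1 := pair_subset_ordEdgeVerts hp
    rcases Sym2.eq_iff.1 h with ⟨rfl, rfl⟩ | ⟨rfl, rfl⟩
    exacts [h1 (by simp), h1 (by simp)]
  symm := ⟨fun _ _ ⟨p, hp, h⟩ => ⟨p, hp, h.trans Sym2.eq_swap⟩⟩

theorem density_le_twoDensity [Fintype V] {J : Finset (OrdEdge H)} (hJ : 2 ≤ J.card) :
    ((J.card : ℝ) - 1) / ((ordEdgeVerts J).card - 2) ≤ twoDensity H := by
  have hv : (ordEdgeSubgraph J).verts.ncard = (ordEdgeVerts J).card := Set.ncard_coe_finset _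
  have he : (ordEdgeSubgraph J).edgeSet.ncard = J.card := by
    have : (ordEdgeSubgraph J).edgeSet = (fun p : OrdEdge H => s(p.1.1, p.1.2)) '' J := by
      ext e
      induction e with
      | _ x y => simp [ordEdgeSubgraph, SimpleGraph.Subgraph.mem_edgeSet]
    rw [this, Set.ncard_image_of_injective _ ordEdge_sym2_injective, Set.ncard_coe_finset]
  -- An unbounded real supremum would take the default value `0`; finiteness of `V` excludes this.
  have hbdd : BddAbove (Set.range fun H' : {H' : H.Subgraph // 3 ≤ H'.verts.ncard} =>
      ((H'.1.edgeSet.ncard : ℝ) - 1) / ((H'.1.verts.ncard : ℝ) - 2)) := Set.finite_range _ |>.bddAbove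
  have := le_ciSup hbdd ⟨ordEdgeSubgraph J, by rw [hv]; exact three_le_card_ordEdgeVerts hJ⟩
  simp only [hv, he] at this
  exact this

theorem card_sub_one_le_twoDensity_mul [Fintype V] {J : Finset (OrdEdge H)} (hJ : 2 ≤ J.card) :
    (J.card : ℝ) - 1 ≤ twoDensity H * ((ordEdgeVerts J).card - 2) := by
  have h3 : (3 : ℝ) ≤ (ordEdgeVerts J).card := by exact_mod_cast three_le_card_ordEdgeVerts hJ
  exact (div_le_iff₀ (by linarith)).1 (density_le_twoDensity hJ)

/-- Two edges span at most four vertices. The bound makes `m₂(H)` positive and the exponent `2 - 1 /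
m₂(H)` nonnegative. -/
theorem half_le_twoDensity [Fintype V] (h : 2 ≤ Fintype.card (OrdEdge H)) :
    1 / 2 ≤ twoDensity H := by
  obtain ⟨J, -, hJ⟩ := Finset.exists_subset_card_eq
    (s := (Finset.univ : Finset (OrdEdge H))) (n := 2) h
  have h1 := density_le_twoDensity (J := J) hJ.ge
  have h3 : (3 : ℝ) ≤ (ordEdgeVerts J).card := by
    exact_mod_cast three_le_card_ordEdgeVerts hJ.ge
  have h4 : ((ordEdgeVerts J).card : ℝ) ≤ 4 := by
    have : (ordEdgeVerts J).card ≤ J.card * 2 :=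
      Finset.card_biUnion_le_card_mul _ _ _ fun p _ => Finset.card_le_two
    rw [hJ] at this
    exact_mod_cast this
  refine le_trans ?_ h1
  rw [hJ, le_div_iff₀ (by linarith)]
  push_cast
  linarith

/-- The map `φ` in the blow-up uses this pair in the place of each edge. -/
def edgeTuple {k n : ℕ} (e : Fin k → OrdEdge H) (φ : V → Fin n) (i : Fin k) :
    OrdEdge H × (Fin n × Fin n) :=
  (e i, (φ (e i).1.1, φ (e i).1.2))

theorem card_agree_le [Fintype V] {α : Type*} [Fintype α] [DecidableEq α] (W : Finset V) (𝒜 : Finset (V → α))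
    (h : ∀ φ ∈ 𝒜, ∀ φ' ∈ 𝒜, ∀ v ∈ W, φ v = φ' v) :
    𝒜.card ≤ Fintype.card α ^ (Fintype.card V - W.card) := by
  rcases 𝒜.eq_empty_or_nonempty with rfl | ⟨φ₀, h₀⟩
  · simp
  have hsub : 𝒜 ⊆ Fintype.piFinset fun v => if v ∈ W then {φ₀ v} else Finset.univ := by
    intro φ hφ
    rw [Fintype.mem_piFinset]
    intro v
    split_ifs with hv
    · exact Finset.mem_singleton.2 (h φ hφ φ₀ h₀ v hv)
    · exact Finset.mem_univ _
  refine (Finset.card_le_card hsub).trans (le_of_eq ?_)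
  rw [Fintype.card_piFinset, ← Finset.prod_mul_prod_compl W]
  rw [Finset.prod_congr rfl fun v hv => by rw [if_pos hv, Finset.card_singleton],
    Finset.prod_congr (s₁ := Wᶜ) rfl fun v hv => by
      rw [if_neg (Finset.mem_compl.1 hv), Finset.card_univ]]
  simp [Finset.card_compl]

/-- The number of canonical copies through given edges is small enough for the container theorem
when `m` is above the threshold given by the 2-density. -/
theorem card_edgeTuple_agree_le [Fintype V] {k n : ℕ} (hn : 0 < n) (e : Fin k ≃ OrdEdge H)
    (x : ℝ) (hk : 2 ≤ k) (hxn : (n : ℝ) ^ (-1 / twoDensity H) ≤ x)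
    (J : Finset (Fin k)) (hJ : J.Nonempty) (y : Fin k → OrdEdge H × (Fin n × Fin n)) :
    ((Finset.univ.filter fun φ : V → Fin n => AgreeOn J y (edgeTuple e φ)).card : ℝ) ≤
      x ^ (J.card - 1) * ((n : ℝ) ^ Fintype.card V / (n : ℝ) ^ 2) := by
  have hn1 : (1 : ℝ) ≤ n := by exact_mod_cast hn
  have hn0 : (0 : ℝ) < n := by linarith
  set J' : Finset (OrdEdge H) := J.map e.toEmbedding with hJ'
  have hJc : J'.card = J.card := Finset.card_map _
  have h1 := card_agree_le (ordEdgeVerts J')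
    (Finset.univ.filter fun φ : V → Fin n => AgreeOn J y (edgeTuple e φ)) (by
      intro φ hφ φ' hφ' v hv
      obtain ⟨p, hp, hvp⟩ := Finset.mem_biUnion.1 hv
      obtain ⟨i, hi, rfl⟩ := Finset.mem_map.1 hp
      have h2 := ((Finset.mem_filter.1 hφ).2 i hi).symm.trans ((Finset.mem_filter.1 hφ').2 i hi)
      simp only [edgeTuple, Prod.mk.injEq, true_and] at h2
      rcases Finset.mem_insert.1 hvp with rfl | hvp
      · exact h2.1
      · rw [Finset.mem_singleton.1 hvp]; exact h2.2)
  rw [Fintype.card_fin] at h1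
  have hvle : (ordEdgeVerts J').card ≤ Fintype.card V := Finset.card_le_univ _
  have hv2 : 2 ≤ (ordEdgeVerts J').card := two_le_card_ordEdgeVerts (by simpa [hJ'] using hJ)
  -- Fixing the edges in `J` fixes `v_J` vertices, and `|J| - 1 ≤ m₂(H) (v_J - 2)` makes `x ^ (|J| -
  -- 1)` at least `n ^ (2 - v_J)`. A single edge needs no density.
  have hmain : 1 ≤ x ^ (J.card - 1) * (n : ℝ) ^ ((ordEdgeVerts J').card - 2) := by
    by_cases hj : 2 ≤ J.card
    · have hm : 1 / 2 ≤ twoDensity H := half_le_twoDensity (by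
        rw [← Fintype.card_congr e, Fintype.card_fin]; exact hk)
      have hd := card_sub_one_le_twoDensity_mul (J := J') (hJc ▸ hj)
      have hm0 : 0 < twoDensity H := by linarith
      have h3 : (n : ℝ) ^ (-(((ordEdgeVerts J').card : ℝ) - 2)) ≤ x ^ (J.card - 1) := by
        refine le_trans ?_ (pow_le_pow_left₀ (by positivity) hxn _)
        rw [← Real.rpow_mul_natCast hn0.le]
        refine Real.rpow_le_rpow_of_exponent_le hn1 ?_
        rw [Nat.cast_sub (by omega), Nat.cast_one, ← hJc, div_mul_eq_mul_div, le_div_iff₀ hm0]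
        linarith
      have h4 : (n : ℝ) ^ (-(((ordEdgeVerts J').card : ℝ) - 2)) =
          ((n : ℝ) ^ ((ordEdgeVerts J').card - 2))⁻¹ := by
        rw [Real.rpow_neg hn0.le, ← Real.rpow_natCast, Nat.cast_sub hv2, Nat.cast_ofNat]
      rw [h4, inv_le_iff_one_le_mul₀ (by positivity)] at h3
      exact h3
    · have hj1 : J.card - 1 = 0 := by omega
      rw [hj1, pow_zero, one_mul]
      exact one_le_pow₀ hn1
  have hsplit : (n : ℝ) ^ Fintype.card V = (n : ℝ) ^ (Fintype.card V - (ordEdgeVerts J').card) *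
      (n : ℝ) ^ ((ordEdgeVerts J').card - 2) * (n : ℝ) ^ 2 := by
    rw [← pow_add, ← pow_add]; congr 1; omega
  calc ((Finset.univ.filter fun φ : V → Fin n => AgreeOn J y (edgeTuple e φ)).card : ℝ)
      ≤ (n : ℝ) ^ (Fintype.card V - (ordEdgeVerts J').card) := by exact_mod_cast h1
    _ ≤ (n : ℝ) ^ (Fintype.card V - (ordEdgeVerts J').card) *
        (x ^ (J.card - 1) * (n : ℝ) ^ ((ordEdgeVerts J').card - 2)) :=
        le_mul_of_one_le_right (by positivity) hmain
    _ = _ := by rw [hsplit]; field_simp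

end OrdEdge

/-! ### Blow-up graphs as tuples of sets of pairs -/

section Blowup

variable {V : Type u} [LinearOrder V] {H : SimpleGraph V} {n : ℕ}

/-- The bipartite graph that `G` induces on the edge `p` of `H`, as a set of pairs. -/
noncomputable def edgeSlice (H : SimpleGraph V) (G : SimpleGraph (V × Fin n)) (p : OrdEdge H) :
    Finset (Fin n × Fin n) :=
  Finset.univ.filter fun q => G.Adj (p.1.1, q.1) (p.1.2, q.2)

theorem hasCanonicalCopy_of_map (G : SimpleGraph (V × Fin n)) (φ : V → Fin n)
    (h : ∀ p : OrdEdge H, (φ p.1.1, φ p.1.2) ∈ edgeSlice H G p) : HasCanonicalCopy H G := by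
  have hadj : ∀ a b, a < b → H.Adj a b → G.Adj (a, φ a) (b, φ b) := fun a b hab hH => by
    simpa [edgeSlice] using h ⟨(a, b), hab, hH⟩
  refine ⟨⟨⟨fun v => (v, φ v), ?_⟩, fun v w hvw => (Prod.ext_iff.1 hvw).1⟩, fun i => ?_⟩
  · intro a b hH
    rcases lt_or_gt_of_ne hH.ne with hlt | hlt
    exacts [hadj a b hlt hH, (hadj b a hlt hH.symm).symm]
  · change (i, φ i) ∈ part n i
    simp [part]

theorem card_interedges_eq (G : SimpleGraph (V × Fin n)) (p : OrdEdge H) (X X' : Finset (Fin n)) :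
    (G.interedges ({p.1.1} ×ˢ X) ({p.1.2} ×ˢ X')).card = (edgeSlice H G p ∩ X ×ˢ X').card := by
  refine (Finset.card_bij (fun q _ => ((p.1.1, q.1), (p.1.2, q.2))) ?_ ?_ ?_).symm
  · intro q hq
    simp only [edgeSlice, Finset.mem_inter, Finset.mem_filter, Finset.mem_univ, true_and,
      Finset.mem_product] at hq
    simp [SimpleGraph.mem_interedges_iff, hq.1, hq.2.1, hq.2.2]
  · intro q _ q' _ h
    simp only [Prod.mk.injEq, true_and] at h
    exact Prod.ext h.1 h.2
  · rintro ⟨⟨a, x⟩, ⟨b, y⟩⟩ h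
    simp only [SimpleGraph.mem_interedges_iff, Finset.mem_product, Finset.mem_singleton] at h
    obtain ⟨⟨rfl, hx⟩, ⟨rfl, hy⟩, hG⟩ := h
    exact ⟨(x, y), by simp [edgeSlice, hx, hy, hG], rfl⟩

theorem card_edgeSlice {m : ℕ} {p ε : ℝ} {G : SimpleGraph (V × Fin n)}
    (hG : G ∈ blowupGraphs H n m p ε) (e : OrdEdge H) : (edgeSlice H G e).card = m := by
  rw [← (hG.2 _ _ e.2.2).1, part, part, card_interedges_eq]
  simp

/-- Since `ε ≤ 1 / 4`, a deviation of `ε p` leaves three quarters of the mean density. Saturation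
uses only this lower bound. -/
theorem edgeSlice_regular {m : ℕ} {ε ε' : ℝ} (hε : ε ≤ ε') (hε4 : ε ≤ 1 / 4) (hn : 0 < n)
    {G : SimpleGraph (V × Fin n)}
    (hG : G ∈ blowupGraphs H n m ((m : ℝ) / (n : ℝ) ^ 2) ε) (e : OrdEdge H) (X X' : Finset (Fin n))
    (hX : ε' * n ≤ X.card) (hX' : ε' * n ≤ X'.card) :
    3 / 4 * ((m : ℝ) / (n : ℝ) ^ 2) * (X.card * X'.card) ≤ (edgeSlice H G e ∩ X ×ˢ X').card := by
  rcases X.eq_empty_or_nonempty with rfl | hXne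
  · simp
  rcases X'.eq_empty_or_nonempty with rfl | hXne'
  · simp
  have hn0 : (0 : ℝ) < n := by exact_mod_cast hn
  have h0 : (0 : ℝ) < X.card := by exact_mod_cast hXne.card_pos
  have h0' : (0 : ℝ) < X'.card := by exact_mod_cast hXne'.card_pos
  have hle : ε * n ≤ ε' * n := mul_le_mul_of_nonneg_right hε hn0.le
  have hsub : ∀ (i : V) (Z : Finset (Fin n)), {i} ×ˢ Z ⊆ part n i := fun i Z =>
    Finset.product_subset_product subset_rfl (Finset.subset_univ _)
  have hpc : ∀ i : V, (part n i).card = n := fun i => by simp [part]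
  have h := (hG.2 _ _ e.2.2).2 ({e.1.1} ×ˢ X) (hsub _ _) ({e.1.2} ×ˢ X') (hsub _ _)
    (by simpa [hpc] using hle.trans hX) (by simpa [hpc] using hle.trans hX')
  rw [SimpleGraph.edgeDensity_def, SimpleGraph.edgeDensity_def, (hG.2 _ _ e.2.2).1,
    card_interedges_eq, hpc, hpc] at h
  simp only [Finset.card_product, Finset.card_singleton, one_mul] at h
  push_cast at h
  have h1 := (abs_le.1 h).1
  rw [← sq] at h1
  have h2 : ε * ((m : ℝ) / (n : ℝ) ^ 2) ≤ 1 / 4 * ((m : ℝ) / (n : ℝ) ^ 2) :=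
    mul_le_mul_of_nonneg_right hε4 (by positivity)
  have h3 : 3 / 4 * ((m : ℝ) / (n : ℝ) ^ 2) ≤
      ((edgeSlice H G e ∩ X ×ˢ X').card : ℝ) / (X.card * X'.card) := by linarith
  exact (le_div_iff₀ (by positivity)).1 h3

/-- There are no edges except over edges of `H`, so graphs can be counted by their slices. -/
theorem edgeSlice_injOn {m : ℕ} {p ε : ℝ} :
    Set.InjOn (edgeSlice H (n := n)) (blowupGraphs H n m p ε) := by
  intro G hG G' hG' h
  have key : ∀ a b x y, a < b → H.Adj a b → (G.Adj (a, x) (b, y) ↔ G'.Adj (a, x) (b, y)) := by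
    intro a b x y hab hH
    have := congrArg (fun s => (x, y) ∈ s) (congrFun h ⟨(a, b), hab, hH⟩)
    simpa [edgeSlice] using this
  ext ⟨a, x⟩ ⟨b, y⟩
  by_cases hH : H.Adj a b
  · rcases lt_or_gt_of_ne hH.ne with hlt | hlt
    · exact key a b x y hlt hH
    · rw [G.adj_comm, G'.adj_comm]
      exact key b a y x hlt hH.symm
  · exact ⟨fun h => absurd (hG.1 _ _ h) hH, fun h => absurd (hG'.1 _ _ h) hH⟩

/-- The copies supported by a set of admissible pairs, for `exists_sparse_intersecting`. -/
noncomputable def pairsOn (C : Finset (OrdEdge H × (Fin n × Fin n))) (a b : V) :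
    Finset (Fin n × Fin n) :=
  Finset.univ.filter fun q => ∃ h : a < b ∧ H.Adj a b, ((⟨(a, b), h⟩ : OrdEdge H), q) ∈ C

theorem card_partialCopies_pairsOn_le [Fintype V] {k : ℕ} (e : Fin k → OrdEdge H)
    (C : Finset (OrdEdge H × (Fin n × Fin n))) :
    (partialCopies H.Adj (pairsOn C) Finset.univ fun _ => (Finset.univ : Finset (Fin n))).card ≤
      (Finset.univ.filter fun φ : V → Fin n => ∀ i, edgeTuple e φ i ∈ C).card := by
  refine Finset.card_le_card fun φ hφ => ?_
  refine Finset.mem_filter.2 ⟨Finset.mem_univ _, fun i => ?_⟩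
  obtain ⟨_, h⟩ := (Finset.mem_filter.1 ((Finset.mem_filter.1 hφ).2 (e i).1.1 (Finset.mem_univ _)
    (e i).1.2 (Finset.mem_univ _) (e i).2.1 (e i).2.2)).2
  exact h

end Blowup

/-! ### From containers to the bound -/

section Counting

variable {V : Type u} [LinearOrder V] [Fintype V] {H : SimpleGraph V}

/-- A set of admissible pairs that supports few copies has a sparse set in one of its slices which
all graphs inside the set meet in a positive proportion. -/
theorem exists_sparse_slice {k : ℕ} (e : Fin k ≃ OrdEdge H) (hk0 : 0 < k) (δ : ℝ) (hδ : 0 < δ)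
    (hδ1 : δ ≤ 1) : ∃ ε : ℝ, 0 < ε ∧ ∃ c : ℝ, 0 < c ∧ ∀ n : ℕ, 0 < n → ∀ m : ℕ,
      ∀ Cs : Finset (OrdEdge H × (Fin n × Fin n)), ∃ (p : OrdEdge H) (B : Finset (Fin n × Fin n)),
      ((Finset.univ.filter fun φ : V → Fin n => ∀ i, edgeTuple e φ i ∈ Cs).card : ℝ) <
        c * (n : ℝ) ^ Fintype.card V → (B.card : ℝ) ≤ δ * (n : ℝ) ^ 2 ∧
        ∀ G ∈ blowupGraphs H n m ((m : ℝ) / (n : ℝ) ^ 2) ε,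
          (∀ p, ∀ q ∈ edgeSlice H G p, (p, q) ∈ Cs) →
          (m : ℝ) / (8 * k) ≤ (edgeSlice H G p ∩ B).card := by
  have hk : Fintype.card (OrdEdge H) = k := by rw [← Fintype.card_congr e, Fintype.card_fin]
  obtain ⟨ε₁, hε₁, c₀, hc₀, hsat⟩ := exists_sparse_intersecting H.Adj k
    (by rw [← hk, Fintype.card_subtype]) hk0 δ hδ hδ1
  refine ⟨min ε₁ (1 / 4), by positivity, c₀, hc₀, fun n hn m Cs => ?_⟩
  by_cases hfew : ((Finset.univ.filter fun φ : V → Fin n => ∀ i, edgeTuple e φ i ∈ Cs).card : ℝ) <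
      c₀ * (n : ℝ) ^ Fintype.card V
  swap
  -- Default values: the slice and `B` must be functions of every `Cs`, so that the container alone
  -- determines them.
  · exact ⟨e ⟨0, hk0⟩, ∅, fun h => absurd h hfew⟩
  have hle : ((partialCopies H.Adj (pairsOn Cs) Finset.univ
      fun _ => (Finset.univ : Finset (Fin n))).card : ℝ) ≤
      (Finset.univ.filter fun φ : V → Fin n => ∀ i, edgeTuple e φ i ∈ Cs).card :=
    Nat.cast_le.2 (card_partialCopies_pairsOn_le e Cs)
  obtain ⟨a, b, hab, hE, B, -, hB, hBF⟩ := hsat (pairsOn Cs) (by simpa using hn)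
    (lt_of_le_of_lt hle (by rw [Fintype.card_fin]; exact hfew))
  rw [Fintype.card_fin] at hB hBF
  refine ⟨⟨(a, b), hab, hE⟩, B, fun _ => ⟨hB, fun G hG hGC => ?_⟩⟩
  have hc := card_edgeSlice hG ⟨(a, b), hab, hE⟩
  have := hBF (edgeSlice H G ⟨(a, b), hab, hE⟩) (fun q hq => Finset.mem_filter.2
    ⟨Finset.mem_univ _, ⟨hab, hE⟩, hGC _ q hq⟩) (fun X X' hX hX' => by
      rw [hc]
      exact edgeSlice_regular (min_le_left _ _) (min_le_right _ _) hn hG _ X X' hX hX')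
  rwa [hc] at this

/-- The edges of a blow-up graph between the parts that correspond to edges of `H`. -/
noncomputable def sliceUnion {n : ℕ} (F : OrdEdge H → Finset (Fin n × Fin n)) :
    Finset (OrdEdge H × (Fin n × Fin n)) :=
  Finset.univ.filter fun x => x.2 ∈ F x.1

/-- Containers for blow-up graphs without canonical copies, for `m` above the threshold. -/
theorem exists_blowup_container {k : ℕ} (e : Fin k ≃ OrdEdge H) (hk2 : 2 ≤ k) (c₀ τ : ℝ)
    (hc₀ : 0 < c₀) (hτ : 0 < τ) : ∃ A : ℝ, 0 < A ∧ ∀ n : ℕ, 0 < n → ∀ m : ℕ, m ≤ n ^ 2 →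
      A * (n : ℝ) ^ (2 - 1 / twoDensity H) ≤ m →
      ∃ (t : ℕ) (T C : Finset (OrdEdge H × (Fin n × Fin n)) →
        Finset (OrdEdge H × (Fin n × Fin n))), (t : ℝ) ≤ τ * m ∧ IsQuery T C ∧
        ∀ G : SimpleGraph (V × Fin n), ¬ HasCanonicalCopy H G →
          (T (sliceUnion (edgeSlice H G))).card ≤ t ∧
          sliceUnion (edgeSlice H G) ⊆ C (sliceUnion (edgeSlice H G)) ∧
          ((Finset.univ.filter fun φ : V → Fin n =>
            ∀ i, edgeTuple e φ i ∈ C (sliceUnion (edgeSlice H G))).card : ℝ) <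
            c₀ * (n : ℝ) ^ Fintype.card V := by
  have hk : Fintype.card (OrdEdge H) = k := by rw [← Fintype.card_congr e, Fintype.card_fin]
  have hkR : (0 : ℝ) < k := by exact_mod_cast (by omega : 0 < k)
  have hk1 : (1 : ℝ) ≤ k := by exact_mod_cast (by omega : 1 ≤ k)
  -- `L = k` because the hypergraph has `k n²` vertices, while `card_edgeTuple_agree_le` divides by
  -- `n²`.
  obtain ⟨c, hc, r, hcont⟩ := exists_container.{u} k k c₀ hkR hc₀
  obtain ⟨η, hη⟩ : ∃ η, η = min c (τ / (r + 1)) := ⟨_, rfl⟩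
  have hη0 : 0 < η := by rw [hη]; positivity
  -- Rounding `η * m` down loses less than `1 ≤ P`, so `b ≥ k * P` remains.
  refine ⟨(k + 1) / η, by positivity, ?_⟩
  intro n hn m hmn hm
  have hn1 : (1 : ℝ) ≤ n := by exact_mod_cast hn
  have hn0 : (0 : ℝ) < n := by linarith
  have hmnR : (m : ℝ) ≤ (n : ℝ) ^ 2 := by exact_mod_cast hmn
  have hm2 : 1 / 2 ≤ twoDensity H := half_le_twoDensity (hk ▸ hk2)
  obtain ⟨P, hP⟩ : ∃ P, P = (n : ℝ) ^ (2 - 1 / twoDensity H) := ⟨_, rfl⟩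
  have hP1 : 1 ≤ P := by
    rw [hP]
    refine Real.one_le_rpow hn1 ?_
    have : 1 / twoDensity H ≤ 2 := by
      rw [div_le_iff₀ (by linarith)]; linarith
    linarith
  rw [← hP] at hm
  obtain ⟨b, hb⟩ : ∃ b, b = ⌊η * m⌋₊ := ⟨_, rfl⟩
  have hbη : (b : ℝ) ≤ η * m := by rw [hb]; exact Nat.floor_le (by positivity)
  have hbP : k * P ≤ b := by
    have h1 : η * m < b + 1 := by rw [hb]; exact Nat.lt_floor_add_one _
    have h2 : (k + 1) * P ≤ η * m := by
      calc ((k : ℝ) + 1) * P = η * ((k + 1) / η * P) := by field_simp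
        _ ≤ η * m := mul_le_mul_of_nonneg_left hm hη0.le
    nlinarith
  have hb1 : 1 ≤ b := by
    have : (1 : ℝ) ≤ b := by nlinarith
    exact_mod_cast this
  have hN : (Fintype.card (OrdEdge H × (Fin n × Fin n)) : ℝ) = k * (n : ℝ) ^ 2 := by
    rw [Fintype.card_prod, hk]; simp [sq]
  have hΦ : (Fintype.card (V → Fin n) : ℝ) = (n : ℝ) ^ Fintype.card V := by simp
  have hbc : (b : ℝ) ≤ c * Fintype.card (OrdEdge H × (Fin n × Fin n)) := by
    rw [hN]
    calc (b : ℝ) ≤ η * m := hbη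
      _ ≤ c * (1 * (n : ℝ) ^ 2) := by
          rw [one_mul]
          exact mul_le_mul (hη ▸ min_le_left _ _) hmnR (Nat.cast_nonneg _) hc.le
      _ ≤ c * (k * (n : ℝ) ^ 2) := by gcongr
  have hxn : (n : ℝ) ^ (-1 / twoDensity H) ≤ b / (k * (n : ℝ) ^ 2) := by
    rw [le_div_iff₀ (by positivity)]
    refine le_trans (le_of_eq ?_) hbP
    have h2 : (n : ℝ) ^ 2 = (n : ℝ) ^ (2 : ℝ) := by norm_cast
    rw [hP, h2, mul_left_comm, ← Real.rpow_add hn0]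
    congr 2; ring
  have : Nonempty (V → Fin n) := ⟨fun _ => ⟨0, hn⟩⟩
  obtain ⟨T, C, hTC, hprop⟩ := hcont b hb1 hbc (edgeTuple e) (by
    intro J hJ y
    rw [hN, hΦ]
    refine (card_edgeTuple_agree_le hn e _ hk2 hxn J hJ y).trans (le_of_eq ?_)
    field_simp)
  refine ⟨r * b, T, C, ?_, hTC, fun G hG => ?_⟩
  · push_cast
    calc (r : ℝ) * b ≤ (r + 1) * (τ / (r + 1) * m) := by
          refine mul_le_mul (by linarith) (hbη.trans ?_) (Nat.cast_nonneg _) (by positivity)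
          exact mul_le_mul_of_nonneg_right (hη ▸ min_le_right _ _) (Nat.cast_nonneg _)
      _ = τ * m := by field_simp
  · rw [← hΦ]
    refine hprop _ fun φ => ?_
    by_contra! hcon
    refine hG (hasCanonicalCopy_of_map G φ fun p => ?_)
    have := hcon (e.symm p)
    simpa [sliceUnion, edgeTuple] using this

/-- Containers turn into a bound on the number of graphs. -/
theorem ncard_canonicalFree_le_of_container {k n m t : ℕ} (e : Fin k ≃ OrdEdge H) (hk0 : 0 < k)
    (hmn : m ≤ n ^ 2) (p ε c δ : ℝ) (hδ0 : 0 ≤ δ) (hδ1 : δ ≤ 1)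
    (ht : (t : ℝ) ≤ 1 / (16 * k) * m)
    (T C : Finset (OrdEdge H × (Fin n × Fin n)) → Finset (OrdEdge H × (Fin n × Fin n)))
    (hTC : IsQuery T C)
    (hprop : ∀ G : SimpleGraph (V × Fin n), ¬ HasCanonicalCopy H G →
      (T (sliceUnion (edgeSlice H G))).card ≤ t ∧
      sliceUnion (edgeSlice H G) ⊆ C (sliceUnion (edgeSlice H G)) ∧
      ((Finset.univ.filter fun φ : V → Fin n =>
        ∀ i, edgeTuple e φ i ∈ C (sliceUnion (edgeSlice H G))).card : ℝ) < c)
    (hsat : ∀ Cs : Finset (OrdEdge H × (Fin n × Fin n)),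
      ∃ (p' : OrdEdge H) (B : Finset (Fin n × Fin n)),
      ((Finset.univ.filter fun φ : V → Fin n => ∀ i, edgeTuple e φ i ∈ Cs).card : ℝ) < c →
      (B.card : ℝ) ≤ δ / 2 * (n : ℝ) ^ 2 ∧ ∀ G ∈ blowupGraphs H n m p ε,
        (∀ p, ∀ q ∈ edgeSlice H G p, (p, q) ∈ Cs) →
        (m : ℝ) / (8 * k) ≤ (edgeSlice H G p' ∩ B).card) :
    ((canonicalFree H n m p ε).ncard : ℝ) ≤ δ ^ ⌈(m : ℝ) / (16 * k)⌉₊ * 2 ^ m *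
      (2 ^ m) ^ k * ((n ^ 2).choose m : ℝ) ^ k := by
  have hk : Fintype.card (OrdEdge H) = k := by rw [← Fintype.card_congr e, Fintype.card_fin]
  have hkR : (0 : ℝ) < k := by exact_mod_cast hk0
  have hk1 : (1 : ℝ) ≤ k := by exact_mod_cast hk0
  have hmnR : (m : ℝ) ≤ (n : ℝ) ^ 2 := by exact_mod_cast hmn
  have hcardQ : Fintype.card (Fin n × Fin n) = n ^ 2 := by simp [sq]
  choose i₀ B hB using hsat
  obtain ⟨𝓕, h𝓕⟩ : ∃ 𝓕 : Finset (OrdEdge H → Finset (Fin n × Fin n)), 𝓕 =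
    Finset.univ.filter fun F => ∃ G ∈ canonicalFree H n m p ε, edgeSlice H G = F := ⟨_, rfl⟩
  have hmem : ∀ F ∈ 𝓕, ∃ G ∈ canonicalFree H n m p ε, edgeSlice H G = F := fun F hF => by
    rw [h𝓕] at hF
    exact (Finset.mem_filter.1 hF).2
  have hncard : (canonicalFree H n m p ε).ncard = 𝓕.card := by
    rw [← (edgeSlice_injOn.mono fun G (hG : G ∈ canonicalFree H n m p ε) => hG.1).ncard_image, ← Set.ncard_coe_finset]
    congr 1
    ext F
    simp [h𝓕]
  have hmeet : ∀ F ∈ 𝓕, ⌈(m : ℝ) / (16 * k)⌉₊ + t ≤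
      (F (i₀ (C (sliceUnion F))) ∩ B (C (sliceUnion F))).card := by
    intro F hF
    obtain ⟨G, hG, rfl⟩ := hmem F hF
    obtain ⟨-, hSC, hfew⟩ := hprop G hG.2
    have h1 := (hB _ hfew).2 G hG.1 fun p q hq =>
      hSC (Finset.mem_filter.2 ⟨Finset.mem_univ _, hq⟩)
    generalize (edgeSlice H G (i₀ (C (sliceUnion (edgeSlice H G)))) ∩
      B (C (sliceUnion (edgeSlice H G)))).card = x at h1 ⊢
    -- One half of the edges in `B` may belong to the fingerprint; the other half lies outside it.
    have h2 : (m : ℝ) / (8 * k) = m / (16 * k) + 1 / (16 * k) * m := by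
      field_simp; ring
    have h3 : 0 ≤ (m : ℝ) / (16 * k) := by positivity
    have htx : t ≤ x := by
      have : (t : ℝ) ≤ x := by linarith
      exact_mod_cast this
    rw [← Nat.le_sub_iff_add_le htx, Nat.ceil_le, Nat.cast_sub htx]
    linarith
  have hBcard : ∀ F ∈ 𝓕, ((B (C (sliceUnion F))).card : ℝ) ≤
      δ * (Fintype.card (Fin n × Fin n) - t : ℕ) := by
    intro F hF
    obtain ⟨G, hG, rfl⟩ := hmem F hF
    refine (hB _ (hprop G hG.2).2.2).1.trans ?_
    -- Hence `t ≤ n² / 2`, which is why `B` has density `δ / 2` rather than `δ`.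
    have h1 : 1 / (16 * k) * (m : ℝ) ≤ (n : ℝ) ^ 2 / 2 := by
      rw [one_div_mul_eq_div, div_le_div_iff₀ (by positivity) (by norm_num)]
      nlinarith
    have h2 : ((n ^ 2 : ℕ) : ℝ) ≤ ((n ^ 2 - t : ℕ) : ℝ) + t := by
      exact_mod_cast Nat.sub_le_iff_le_add.1 le_rfl
    rw [hcardQ]
    calc δ / 2 * (n : ℝ) ^ 2 = δ * ((n : ℝ) ^ 2 / 2) := by ring
      _ ≤ _ := by
        refine mul_le_mul_of_nonneg_left ?_ hδ0
        push_cast at h2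
        linarith
  have hbound := card_le_of_fingerprint m ⌈(m : ℝ) / (16 * k)⌉₊ t δ hδ0 hδ1 𝓕
    (fun F hF p => by
      obtain ⟨G, hG, rfl⟩ := hmem F hF
      exact card_edgeSlice hG.1 p)
    (fun F p => Finset.univ.filter fun q => (p, q) ∈ T (sliceUnion F))
    (fun F => i₀ (C (sliceUnion F))) (fun F => B (C (sliceUnion F)))
    (fun F _ p q hq => by
      have := hTC.1 _ (Finset.mem_filter.1 hq).2
      exact (Finset.mem_filter.1 this).2)
    (fun F hF => by
      obtain ⟨G, hG, rfl⟩ := hmem F hF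
      refine le_trans ?_ (hprop G hG.2).1
      exact Finset.card_le_card_of_injOn (fun q => (_, q)) (fun q hq => (Finset.mem_filter.1 hq).2)
        (fun q _ q' _ h => (Prod.ext_iff.1 h).2))
    (fun F _ F' _ h => by
      have hT : T (sliceUnion F) = T (sliceUnion F') := by
        ext ⟨p, q⟩
        have := congrArg (fun s => q ∈ s) (congrFun h p)
        simpa using this
      have hC := hTC.out_eq hT
      exact ⟨congrArg i₀ hC, congrArg B hC⟩)
    hBcard hmeet
  rw [hncard]
  rwa [hcardQ, hk] at hbound

/-- The bound for graphs with at least two edges. -/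
theorem exists_ncard_canonicalFree_le (hH : 2 ≤ Fintype.card (OrdEdge H)) (β : ℝ) (hβ : 0 < β) :
    ∃ A : ℝ, 0 < A ∧ ∃ ε : ℝ, 0 < ε ∧ ∀ n : ℕ, 0 < n → ∀ m : ℕ,
      A * (n : ℝ) ^ (2 - 1 / twoDensity H) ≤ m →
        ((canonicalFree H n m ((m : ℝ) / (n : ℝ) ^ 2) ε).ncard : ℝ) ≤
          β ^ m * ((n ^ 2).choose m : ℝ) ^ Fintype.card (OrdEdge H) := by
  obtain ⟨k, hk⟩ : ∃ k, k = Fintype.card (OrdEdge H) := ⟨_, rfl⟩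
  rw [← hk] at hH ⊢
  have hk0 : 0 < k := by omega
  have hkR : (0 : ℝ) < k := by exact_mod_cast hk0
  let e : Fin k ≃ OrdEdge H := (Fintype.equivFinOfCardEq hk.symm).symm
  obtain ⟨β₀, hβ₀⟩ : ∃ β₀, β₀ = min β 1 := ⟨_, rfl⟩
  have hβ₀0 : 0 < β₀ := by rw [hβ₀]; positivity
  have hβ₀1 : β₀ ≤ 1 := hβ₀ ▸ min_le_right _ _
  have hβ₀β : β₀ ≤ β := hβ₀ ▸ min_le_left _ _
  -- `g` absorbs the factors `2 ^ m` and `(2 ^ m) ^ k`; the exponent `16 * k` in `δ` undoes the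
  -- division in `⌈m / (16 * k)⌉`.
  obtain ⟨g, hg⟩ : ∃ g, g = β₀ / 2 ^ (k + 1) := ⟨_, rfl⟩
  have hg0 : 0 < g := by rw [hg]; positivity
  have hg1 : g ≤ 1 := by
    rw [hg, div_le_one (by positivity)]
    exact hβ₀1.trans (one_le_pow₀ (by norm_num))
  obtain ⟨δ, hδ⟩ : ∃ δ, δ = g ^ (16 * k) := ⟨_, rfl⟩
  have hδ0 : 0 < δ := by rw [hδ]; positivity
  have hδ1 : δ ≤ 1 := by rw [hδ]; exact pow_le_one₀ hg0.le hg1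
  obtain ⟨ε, hε, c₀, hc₀, hsat⟩ := exists_sparse_slice e hk0 (δ / 2) (by positivity) (by linarith)
  obtain ⟨A, hA, hcont⟩ := exists_blowup_container e hH c₀ (1 / (16 * k)) hc₀ (by positivity)
  refine ⟨A, hA, ε, hε, ?_⟩
  intro n hn m hm
  rcases (canonicalFree H n m ((m : ℝ) / (n : ℝ) ^ 2) ε).eq_empty_or_nonempty with
    hempty | ⟨G₀, hG₀⟩
  · rw [hempty, Set.ncard_empty, Nat.cast_zero]
    positivity
  have hmn : m ≤ n ^ 2 := by
    rw [← card_edgeSlice hG₀.1 (e ⟨0, hk0⟩)]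
    refine (Finset.card_le_univ _).trans (le_of_eq ?_)
    simp [sq]
  obtain ⟨t, T, C, ht, hTC, hprop⟩ := hcont n hn m hmn hm
  refine (ncard_canonicalFree_le_of_container e hk0 hmn _ ε _ δ hδ0.le hδ1 ht T C hTC hprop
    (hsat n hn m)).trans ?_
  refine mul_le_mul_of_nonneg_right ?_ (by positivity)
  have h1 : δ ^ ⌈(m : ℝ) / (16 * k)⌉₊ ≤ g ^ m := by
    rw [hδ, ← pow_mul]
    refine pow_le_pow_of_le_one hg0.le hg1 ?_
    have : (m : ℝ) / (16 * k) ≤ ⌈(m : ℝ) / (16 * k)⌉₊ := Nat.le_ceil _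
    rw [div_le_iff₀ (by positivity)] at this
    have h3 : (m : ℝ) ≤ ((16 * k * ⌈(m : ℝ) / (16 * k)⌉₊ : ℕ) : ℝ) := by
      push_cast; linarith
    exact_mod_cast h3
  calc δ ^ ⌈(m : ℝ) / (16 * k)⌉₊ * 2 ^ m * (2 ^ m) ^ k ≤ g ^ m * 2 ^ m * (2 ^ m) ^ k := by gcongr
    _ = (g * 2 ^ (k + 1)) ^ m := by
        rw [mul_pow, ← pow_mul, ← pow_mul, mul_assoc, ← pow_add]
        congr 2; ring
    _ = β₀ ^ m := by
        congr 1; rw [hg]; field_simp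
    _ ≤ β ^ m := pow_le_pow_left₀ hβ₀0.le hβ₀β m

/-- The bound for graphs with at most one edge. -/
theorem ncard_canonicalFree_le_of_card_le_one (hH : Fintype.card (OrdEdge H) ≤ 1) (β ε p : ℝ)
    (hβ : 0 < β) (n m : ℕ) (hn : 0 < n) :
    ((canonicalFree H n m p ε).ncard : ℝ) ≤
      β ^ m * ((n ^ 2).choose m : ℝ) ^ Fintype.card (OrdEdge H) := by
  rcases (canonicalFree H n m p ε).eq_empty_or_nonempty with hempty | ⟨G₀, hG₀⟩
  · rw [hempty, Set.ncard_empty, Nat.cast_zero]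
    positivity
  have hsub : Subsingleton (OrdEdge H) := Fintype.card_le_one_iff_subsingleton.1 hH
  -- With at most one edge in `H`, any pair in its slice extends to a canonical copy; only the empty
  -- graph can remain.
  have hm : m = 0 := by
    by_contra hm
    refine hG₀.2 ?_
    by_cases hne : Nonempty (OrdEdge H)
    · obtain ⟨e⟩ := hne
      have hc := card_edgeSlice hG₀.1 e
      obtain ⟨q, hq⟩ := Finset.card_pos.1 (by omega : 0 < (edgeSlice H G₀ e).card)
      refine hasCanonicalCopy_of_map G₀ (fun v => if v = e.1.1 then q.1 else q.2) fun e' => ?_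
      obtain rfl := Subsingleton.elim e e'
      simpa [e.2.1.ne'] using hq
    · exact hasCanonicalCopy_of_map G₀ (fun _ => ⟨0, hn⟩) fun e => absurd ⟨e⟩ hne
  subst hm
  have h1 : (canonicalFree H n 0 p ε).ncard ≤ 1 := by
    rw [Set.ncard_le_one_iff]
    intro G G' hG hG'
    refine edgeSlice_injOn hG.1 hG'.1 ?_
    funext e
    rw [Finset.card_eq_zero.1 (card_edgeSlice hG.1 e), Finset.card_eq_zero.1 (card_edgeSlice hG'.1 e)]
  simpa using (by exact_mod_cast h1 : ((canonicalFree H n 0 p ε).ncard : ℝ) ≤ 1)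

end Counting

end

end KLR

theorem theorem1p8 {V : Type*} [Finite V] (H : SimpleGraph V) (β : ℝ) (hβ : 0 < β) :
    ∃ C : ℝ, 0 < C ∧ ∃ n₀ : ℕ, 0 < n₀ ∧ ∃ ε : ℝ, 0 < ε ∧
      ∀ n : ℕ, n₀ ≤ n → ∀ m : ℕ,
        -- for graphs with at most one edge, no lower bound on m is imposed
        (2 ≤ H.edgeSet.ncard → C * (n : ℝ) ^ (2 - 1 / KLR.twoDensity H) ≤ (m : ℝ)) →
        ((KLR.canonicalFree H n m ((m : ℝ) / (n : ℝ) ^ 2) ε).ncard : ℝ) ≤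
          β ^ m * ((n ^ 2).choose m : ℝ) ^ H.edgeSet.ncard := by
  have : Fintype V := Fintype.ofFinite V
  classical
  -- Any order will do: it only orients the edges of `H`.
  let : LinearOrder V := linearOrderOfSTO WellOrderingRel
  rw [← KLR.card_ordEdge]
  by_cases hH : 2 ≤ Fintype.card (KLR.OrdEdge H)
  · obtain ⟨C, hC, ε, hε, h⟩ := KLR.exists_ncard_canonicalFree_le hH β hβ
    exact ⟨C, hC, 1, one_pos, ε, hε, fun n hn m hm => h n hn m (hm hH)⟩
  · exact ⟨1, one_pos, 1, one_pos, 1, one_pos, fun n hn m _ =>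
      KLR.ncard_canonicalFree_le_of_card_le_one (by omega) β 1 _ hβ n m hn⟩
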